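/- Let $n\ge 2$ and let $(M,g)$ be a connected smooth $(n+1)$-dimensional pseudo-Riemannian manifold (without boundary, $g$ of arbitrary signature) which is vacuum, possibly with a cosmological constant, i.e. $\mathrm{Ric}=\lambda g$ for some constant $\lambda\in\mathbb R$. Let $K_0,\dots,K_{n-2}$ be $n-1$ smooth Killing vector fields on $M$ which commute, $[K_\mu,K_\nu]=0$, and are linearly independent over $\mathbb R$ as vector fields (i.e. no nontrivial linear combination with constant coefficients vanishes identically). Denote by the same symbols the associated one-forms $g(K_\mu,\cdot)$. If $$\{p\in M : K_0\wedge\cdots\wedge K_{n-2}|_p=0\}\neq\emptyset,$$ then, everywhere on $M$, $$dK_\mu\wedge K_0\wedge\cdots\wedge K_{n-2}=0\qquad\text{for all }\mu=0,\dots,n-2 .$$ -/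

import Mathlib

open scoped Manifold ContDiff

noncomputable section

namespace KillingGeometry

/-! ### Coordinate calculus on `ℝᵈ` -/

/-- The `i`-th standard basis vector of `ℝᵈ`. -/
abbrev basisVec {d : ℕ} (i : Fin d) : EuclideanSpace ℝ (Fin d) :=
  EuclideanSpace.single i (1 : ℝ)

/-- The partial derivative `∂ᵢ F` of a function of `d` real variables. -/
def pd {d : ℕ} (i : Fin d) (F : EuclideanSpace ℝ (Fin d) → ℝ)
    (y : EuclideanSpace ℝ (Fin d)) : ℝ :=
  fderiv ℝ F y (basisVec i)

/-- The Christoffel symbols `Γᵏᵢⱼ = ½ gᵏˡ (∂ᵢ gⱼₗ + ∂ⱼ gᵢₗ - ∂ₗ gᵢⱼ)` of a matrix `G = (gᵢⱼ)` of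
metric coefficients. -/
def christoffel {d : ℕ} (G : EuclideanSpace ℝ (Fin d) → Matrix (Fin d) (Fin d) ℝ)
    (k i j : Fin d) (y : EuclideanSpace ℝ (Fin d)) : ℝ :=
  (1 / 2) * ∑ l, (G y)⁻¹ k l *
    (pd i (fun z => G z j l) y + pd j (fun z => G z i l) y - pd l (fun z => G z i j) y)

/-- The Ricci tensor
`Rᵢⱼ = ∂ₖ Γᵏᵢⱼ - ∂ⱼ Γᵏᵢₖ + Γᵏₖₗ Γˡᵢⱼ - Γᵏⱼₗ Γˡᵢₖ` (summed over `k` and `l`)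
of a matrix `G = (gᵢⱼ)` of metric coefficients. -/
def ricciCoeff {d : ℕ} (G : EuclideanSpace ℝ (Fin d) → Matrix (Fin d) (Fin d) ℝ)
    (i j : Fin d) (y : EuclideanSpace ℝ (Fin d)) : ℝ :=
  (∑ k, (pd k (christoffel G k i j) y - pd j (christoffel G k i k) y)) +
    ∑ k, ∑ l, (christoffel G k k l y * christoffel G l i j y -
      christoffel G k j l y * christoffel G l i k y)

/-! ### Pseudo-Riemannian manifolds

A `d`-dimensional smooth manifold without boundary is a space `M` with a smooth atlas of charts with
values in `ℝᵈ`. A chart is a member `φ` of the maximal smooth atlas; its coordinate vectors and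
coordinate differentials are those of the local coordinates `φ¹, …, φᵈ`. -/

/-- A smooth pseudo-Riemannian metric on a `d`-dimensional manifold: a smooth field of nondegenerate
symmetric bilinear forms, of arbitrary signature, on the tangent spaces. -/
structure PseudoRiemannianMetric (d : ℕ) (M : Type*) [TopologicalSpace M]
    [ChartedSpace (EuclideanSpace ℝ (Fin d)) M] [IsManifold (𝓡 d) ∞ M] where
  /-- The bilinear form on each tangent space. -/
  inner (p : M) : TangentSpace (𝓡 d) p →L[ℝ] TangentSpace (𝓡 d) p →L[ℝ] ℝ
  symm (p : M) (v w : TangentSpace (𝓡 d) p) : inner p v w = inner p w v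
  nondegenerate (p : M) (v : TangentSpace (𝓡 d) p) (hv : ∀ w, inner p v w = 0) : v = 0
  contMDiff : ContMDiff (𝓡 d)
    ((𝓡 d).prod 𝓘(ℝ, EuclideanSpace ℝ (Fin d) →L[ℝ] EuclideanSpace ℝ (Fin d) →L[ℝ] ℝ)) ∞
    (fun p : M => Bundle.TotalSpace.mk'
      (EuclideanSpace ℝ (Fin d) →L[ℝ] EuclideanSpace ℝ (Fin d) →L[ℝ] ℝ)
      (E := fun p : M => TangentSpace (𝓡 d) p →L[ℝ] TangentSpace (𝓡 d) p →L[ℝ] ℝ) p (inner p))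

section Charts

variable {d : ℕ} {M : Type*} [TopologicalSpace M] [ChartedSpace (EuclideanSpace ℝ (Fin d)) M]

/-- The coordinate vector `∂ᵢ` of the chart `φ`, at the point with coordinates `y`. -/
def coordVec (φ : OpenPartialHomeomorph M (EuclideanSpace ℝ (Fin d))) (i : Fin d)
    (y : EuclideanSpace ℝ (Fin d)) : TangentSpace (𝓡 d) (φ.symm y) :=
  mfderiv (𝓡 d) (𝓡 d) φ.symm y (basisVec i)

/-- The coordinate differential `dxⁱ` of the chart `φ`, a covector at the point `p`. -/
def coordCovec (φ : OpenPartialHomeomorph M (EuclideanSpace ℝ (Fin d))) (i : Fin d) (p : M) :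
    Module.Dual ℝ (TangentSpace (𝓡 d) p) :=
  (EuclideanSpace.proj (𝕜 := ℝ) i : EuclideanSpace ℝ (Fin d) →L[ℝ] ℝ).toLinearMap ∘ₗ
    (mfderiv (𝓡 d) (𝓡 d) φ p).toLinearMap

/-- The components `Xⁱ = dxⁱ(X)` of a vector field `X` in the chart `φ`, as functions of the
coordinates. -/
def vecCoeff (φ : OpenPartialHomeomorph M (EuclideanSpace ℝ (Fin d)))
    (X : ∀ p : M, TangentSpace (𝓡 d) p) (i : Fin d) (y : EuclideanSpace ℝ (Fin d)) : ℝ :=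
  coordCovec φ i (φ.symm y) (X (φ.symm y))

/-- The components `αᵢ = α(∂ᵢ)` of a one-form `α` in the chart `φ`, as functions of the
coordinates. -/
def formCoeff (φ : OpenPartialHomeomorph M (EuclideanSpace ℝ (Fin d)))
    (α : ∀ p : M, Module.Dual ℝ (TangentSpace (𝓡 d) p)) (i : Fin d)
    (y : EuclideanSpace ℝ (Fin d)) : ℝ :=
  α (φ.symm y) (coordVec φ i y)

/-- The exterior derivative `dα = ∑ᵢⱼ ∂ᵢ αⱼ dxⁱ ∧ dxʲ` of a one-form `α` at a point `p` of the domain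
of the chart `φ`, as an element of the exterior algebra of the cotangent space at `p`. -/
def extDerivOneForm (φ : OpenPartialHomeomorph M (EuclideanSpace ℝ (Fin d)))
    (α : ∀ p : M, Module.Dual ℝ (TangentSpace (𝓡 d) p)) (p : M) :
    ExteriorAlgebra ℝ (Module.Dual ℝ (TangentSpace (𝓡 d) p)) :=
  ∑ i, ∑ j, pd i (formCoeff φ α j) (φ p) •
    (ExteriorAlgebra.ι ℝ (coordCovec φ i p) * ExteriorAlgebra.ι ℝ (coordCovec φ j p))

/-- The wedge product `α₀ ∧ … ∧ αₘ₋₁` at `p` of a family of one-forms. -/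
def wedge {m : ℕ} (α : Fin m → ∀ p : M, Module.Dual ℝ (TangentSpace (𝓡 d) p)) (p : M) :
    ExteriorAlgebra ℝ (Module.Dual ℝ (TangentSpace (𝓡 d) p)) :=
  ExteriorAlgebra.ιMulti ℝ m (fun μ => α μ p)

variable [IsManifold (𝓡 d) ∞ M]

/-- The one-form `g(X, ·)` associated with a vector field `X`. -/
def flat (g : PseudoRiemannianMetric d M) (X : ∀ p : M, TangentSpace (𝓡 d) p) (p : M) :
    Module.Dual ℝ (TangentSpace (𝓡 d) p) :=
  (g.inner p (X p)).toLinearMap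

/-- The matrix `gᵢⱼ = g(∂ᵢ, ∂ⱼ)` of the metric in the chart `φ`, as a function of the coordinates. -/
def metricCoeff (g : PseudoRiemannianMetric d M)
    (φ : OpenPartialHomeomorph M (EuclideanSpace ℝ (Fin d)))
    (y : EuclideanSpace ℝ (Fin d)) : Matrix (Fin d) (Fin d) ℝ :=
  Matrix.of fun i j => g.inner (φ.symm y) (coordVec φ i y) (coordVec φ j y)

/-- The vacuum Einstein equations, possibly with a cosmological constant: in all local coordinates
`Rᵢⱼ = l gᵢⱼ` for one real constant `l` (in dimension at least three this is the equation
`Ric - ½ R g + Λ g = 0` for some constant `Λ`). -/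
def IsVacuum (g : PseudoRiemannianMetric d M) : Prop :=
  ∃ l : ℝ, ∀ φ ∈ IsManifold.maximalAtlas (𝓡 d) ∞ M, ∀ y ∈ φ.target, ∀ i j : Fin d,
    ricciCoeff (metricCoeff g φ) i j y = l * metricCoeff g φ y i j

/-- A smooth vector field `X` is a Killing field if the Lie derivative of `g` along `X` vanishes: in
all local coordinates `∑ₖ (Xᵏ ∂ₖ gᵢⱼ + gₖⱼ ∂ᵢ Xᵏ + gᵢₖ ∂ⱼ Xᵏ) = 0`. -/
structure IsKilling (g : PseudoRiemannianMetric d M) (X : ∀ p : M, TangentSpace (𝓡 d) p) :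
    Prop where
  contMDiff : ContMDiff (𝓡 d) (𝓡 d).tangent ∞
    (fun p : M => (⟨p, X p⟩ : TangentBundle (𝓡 d) M))
  lieDeriv_eq_zero : ∀ φ ∈ IsManifold.maximalAtlas (𝓡 d) ∞ M, ∀ y ∈ φ.target, ∀ i j : Fin d,
    ∑ k, (vecCoeff φ X k y * pd k (fun z => metricCoeff g φ z i j) y +
      metricCoeff g φ y k j * pd i (vecCoeff φ X k) y +
      metricCoeff g φ y i k * pd j (vecCoeff φ X k) y) = 0

end Charts

end KillingGeometry

end

/-!
# Twist of commuting Killing fields with a degenerate point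

Let `F` be the bivector obtained from `dK_μ` by raising both indices. In local coordinates, consider
the function `ω = ∑ Fᵃᵇ det(eₐ, e_b, K₀, …, Kₘ₋₁)` (`twistFun`, with `m + 2` the dimension of the
manifold), which up to a constant factor is `*(dK_μ ∧ K₀ ∧ … ∧ Kₘ₋₁)` divided by the density
`√|det g|`. It satisfies `∂ₑ ω = -Γᵃₑₐ ω` (`pd_twistFun_eq`), which says that `√|det g| ω` is
locally constant. By Grönwall's inequality the zero set of `ω` is then open in each chart; it is
closed by continuity, it does not depend on the chart, and it contains the points where
`K₀ ∧ … ∧ Kₘ₋₁ = 0`. Since the manifold is connected, `ω` vanishes everywhere. Working with `ω`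
rather than with `√|det g| ω` avoids differentiating determinants of the metric and any discussion
of orientations.

The differential equation for `ω` is Cartan's formula for `d (i_{K₀} ⋯ i_{Kₘ₋₁} *F)`, which in
coordinates is a purely algebraic identity (`twist_derivative_eq_zero`): Cramer's rule is a linear
relation between a vector `e` and `eₐ, e_b, K₀, …, Kₘ₋₁`, and contracting it with the derivative of
`F` leaves the divergence of `F` and the Lie derivatives of `F` along the `K i`. Three facts then
enter.

* The fields commute and preserve the metric, so that they preserve `F` (`sum_smul_pdMat_curlUp`).
* Killing fields are divergence free (`trace_jacobian`).
* The contracted Ricci identity and the Einstein equations give `∇ₐ Fᵃᵇ = -2 λ K_μᵇ`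
  (`div_curlUp`), and the contribution of this term is a determinant with the vector `K_μ` in two
  slots.

All these identities hold also at points where the fields are linearly dependent.
-/

noncomputable section

namespace KillingGeometry

/-! ### Determinants of frames -/

/-- Cramer's rule: `d + 1` vectors of a `d`-dimensional space satisfy a linear relation whose
coefficients are determinants. -/
theorem sum_det_updateRow_mul {ι : Type*} [Fintype ι] [DecidableEq ι] (V : Matrix ι ι ℝ)
    (w : ι → ℝ) (c : ι) : ∑ i, (V.updateRow i w).det * V i c = V.det * w c := by
  have h := congrFun (Matrix.mulVec_cramer V.transpose w) c
  simp only [Matrix.mulVec, dotProduct, Matrix.cramer_transpose_apply, Matrix.det_transpose,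
    Matrix.transpose_apply, Pi.smul_apply, smul_eq_mul] at h
  rw [← h]
  exact Finset.sum_congr rfl fun i _ => mul_comm _ _

/-- An endomorphism, acting on the rows of a determinant as a derivation, multiplies it by its
trace. -/
theorem sum_det_updateRow_mulVec {ι : Type*} [Fintype ι] [DecidableEq ι] (V A : Matrix ι ι ℝ) :
    ∑ i, (V.updateRow i (A.mulVec (V i))).det = A.trace * V.det := by
  have h : ∀ i, (V.updateRow i (A.mulVec (V i))).det =
      (V.transpose.adjugate * (A * V.transpose)) i i := by
    intro i
    rw [← Matrix.cramer_transpose_apply, Matrix.cramer_eq_adjugate_mulVec]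
    rfl
  have h2 : ∑ i, (V.updateRow i (A.mulVec (V i))).det =
      (V.transpose.adjugate * (A * V.transpose)).trace :=
    Finset.sum_congr rfl fun i _ => h i
  rw [h2, Matrix.trace_mul_comm, Matrix.mul_assoc, Matrix.mul_adjugate, Matrix.mul_smul,
    Matrix.mul_one, Matrix.trace_smul, Matrix.det_transpose, smul_eq_mul, mul_comm]

section Frames

variable {m : ℕ}

/-- The determinant of the frame `a, b, K₀, …, Kₘ₋₁` of `ℝᵐ⁺²`. -/
def frameDet (a b : Fin (m + 2) → ℝ) (K : Fin m → Fin (m + 2) → ℝ) : ℝ :=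
  Matrix.detRowAlternating (R := ℝ) (n := Fin (m + 2)) (Fin.cons a (Fin.cons b K : Fin (m + 1) → _))

/-- The contraction `∑ Fᵃᵇ det(eₐ, e_b, K₀, …, Kₘ₋₁)` of a bivector with a family of `m` vectors. -/
def twist (F : Fin (m + 2) → Fin (m + 2) → ℝ) (K : Fin m → Fin (m + 2) → ℝ) : ℝ :=
  ∑ a, ∑ b, F a b * frameDet (Pi.single a 1) (Pi.single b 1) K

theorem frameDet_eq_det (a b : Fin (m + 2) → ℝ) (K : Fin m → Fin (m + 2) → ℝ) :
    frameDet a b K =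
      Matrix.det (Matrix.of (Fin.cons a (Fin.cons b K : Fin (m + 1) → Fin (m + 2) → ℝ))) := rfl

theorem updateRow_cons_zero (a b w : Fin (m + 2) → ℝ) (K : Fin m → Fin (m + 2) → ℝ) :
    (Matrix.of (Fin.cons a (Fin.cons b K : Fin (m + 1) → Fin (m + 2) → ℝ))).updateRow 0 w =
      Matrix.of (Fin.cons w (Fin.cons b K : Fin (m + 1) → Fin (m + 2) → ℝ)) :=
  Fin.update_cons_zero (α := fun _ => Fin (m + 2) → ℝ) _ _ _

theorem updateRow_cons_one (a b w : Fin (m + 2) → ℝ) (K : Fin m → Fin (m + 2) → ℝ) :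
    (Matrix.of (Fin.cons a (Fin.cons b K : Fin (m + 1) → Fin (m + 2) → ℝ))).updateRow
      (Fin.succ 0) w = Matrix.of (Fin.cons a (Fin.cons w K : Fin (m + 1) → Fin (m + 2) → ℝ)) := by
  refine (Fin.cons_update (α := fun _ => Fin (m + 2) → ℝ) _ _ _ _).symm.trans ?_
  rw [Fin.update_cons_zero]
  rfl

theorem updateRow_cons_succ (a b w : Fin (m + 2) → ℝ) (K : Fin m → Fin (m + 2) → ℝ) (i : Fin m) :
    (Matrix.of (Fin.cons a (Fin.cons b K : Fin (m + 1) → Fin (m + 2) → ℝ))).updateRow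
      i.succ.succ w =
      Matrix.of (Fin.cons a (Fin.cons b (Function.update K i w) :
        Fin (m + 1) → Fin (m + 2) → ℝ)) := by
  refine (Fin.cons_update (α := fun _ => Fin (m + 2) → ℝ) _ _ _ _).symm.trans ?_
  rw [← Fin.cons_update]
  rfl

theorem frameDet_cramer (a b w : Fin (m + 2) → ℝ) (K : Fin m → Fin (m + 2) → ℝ)
    (c : Fin (m + 2)) :
    frameDet w b K * a c + (frameDet a w K * b c +
      ∑ i, frameDet a b (Function.update K i w) * K i c) = frameDet a b K * w c := by
  have h := sum_det_updateRow_mul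
    (Matrix.of (Fin.cons a (Fin.cons b K : Fin (m + 1) → Fin (m + 2) → ℝ))) w c
  rw [Fin.sum_univ_succ, Fin.sum_univ_succ] at h
  simp only [updateRow_cons_zero, updateRow_cons_one, updateRow_cons_succ] at h
  exact h

theorem frameDet_trace (a b : Fin (m + 2) → ℝ) (K : Fin m → Fin (m + 2) → ℝ)
    (A : Matrix (Fin (m + 2)) (Fin (m + 2)) ℝ) :
    frameDet (A.mulVec a) b K + (frameDet a (A.mulVec b) K +
      ∑ i, frameDet a b (Function.update K i (A.mulVec (K i)))) = A.trace * frameDet a b K := by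
  have h := sum_det_updateRow_mulVec
    (Matrix.of (Fin.cons a (Fin.cons b K : Fin (m + 1) → Fin (m + 2) → ℝ))) A
  rw [Fin.sum_univ_succ, Fin.sum_univ_succ] at h
  simp only [updateRow_cons_zero, updateRow_cons_one, updateRow_cons_succ] at h
  exact h

theorem frameDet_sum_left (x b : Fin (m + 2) → ℝ) (K : Fin m → Fin (m + 2) → ℝ) :
    frameDet x b K = ∑ a, x a * frameDet (Pi.single a 1) b K := by
  have h : ∀ y, frameDet y b K =
      (Matrix.detRowAlternating (R := ℝ) (n := Fin (m + 2))).toMultilinearMap.toLinearMap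
      (Fin.cons 0 (Fin.cons b K : Fin (m + 1) → Fin (m + 2) → ℝ)) 0 y := by
    intro y
    simp only [MultilinearMap.toLinearMap_apply, Fin.update_cons_zero]
    rfl
  rw [h, LinearMap.pi_apply_eq_sum_univ]
  refine Finset.sum_congr rfl fun a _ => ?_
  rw [h, smul_eq_mul]
  congr 2
  ext j
  simp [Pi.single_apply, eq_comm]

theorem frameDet_swap (a b : Fin (m + 2) → ℝ) (K : Fin m → Fin (m + 2) → ℝ) :
    frameDet b a K = - frameDet a b K := by
  rw [frameDet, frameDet, ← AlternatingMap.map_swap _ _ (show (0 : Fin (m + 2)) ≠ Fin.succ 0 from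
    (Fin.succ_ne_zero _).symm)]
  congr 1
  ext j
  refine Fin.cases ?_ (fun j => Fin.cases ?_ (fun j => ?_) j) j
  · simp
  · simp
  · rw [Function.comp_apply, Equiv.swap_apply_of_ne_of_ne (Fin.succ_ne_zero _)
      (fun h => Fin.succ_ne_zero _ (Fin.succ_injective _ h))]
    rfl

theorem frameDet_sum_right (a x : Fin (m + 2) → ℝ) (K : Fin m → Fin (m + 2) → ℝ) :
    frameDet a x K = ∑ b, x b * frameDet a (Pi.single b 1) K := by
  rw [frameDet_swap, frameDet_sum_left, ← Finset.sum_neg_distrib]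
  refine Finset.sum_congr rfl fun b _ => ?_
  rw [frameDet_swap (Pi.single b 1) a, mul_neg]

theorem frameDet_swap_update (a b w u : Fin (m + 2) → ℝ) (K : Fin m → Fin (m + 2) → ℝ)
    {i j : Fin m} (h : i ≠ j) :
    frameDet a b (Function.update (Function.update K i w) j u) =
      - frameDet a b (Function.update (Function.update K j w) i u) := by
  have hij : (i.succ.succ : Fin (m + 2)) ≠ j.succ.succ := fun e =>
    h (Fin.succ_injective _ (Fin.succ_injective _ e))
  rw [frameDet, frameDet, ← AlternatingMap.map_swap _ _ hij]
  congr 1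
  ext l
  refine Fin.cases ?_ (fun l => Fin.cases ?_ (fun l => ?_) l) l
  · rw [Function.comp_apply, Equiv.swap_apply_of_ne_of_ne (Fin.succ_ne_zero _).symm
      (Fin.succ_ne_zero _).symm]
    rfl
  · rw [Function.comp_apply, Equiv.swap_apply_of_ne_of_ne]
    · rfl
    · exact fun e => Fin.succ_ne_zero _ (Fin.succ_injective _ e).symm
    · exact fun e => Fin.succ_ne_zero _ (Fin.succ_injective _ e).symm
  · rw [Function.comp_apply]
    rcases eq_or_ne l i with rfl | hi
    · rw [Equiv.swap_apply_left, Fin.cons_succ, Fin.cons_succ, Fin.cons_succ, Fin.cons_succ,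
        Function.update_of_ne h, Function.update_self, Function.update_of_ne h.symm,
        Function.update_self]
    rcases eq_or_ne l j with rfl | hj
    · rw [Equiv.swap_apply_right, Fin.cons_succ, Fin.cons_succ, Fin.cons_succ, Fin.cons_succ,
        Function.update_self, Function.update_self]
    rw [Equiv.swap_apply_of_ne_of_ne]
    · simp [hi, hj]
    · exact fun e => hi (Fin.succ_injective _ (Fin.succ_injective _ e))
    · exact fun e => hj (Fin.succ_injective _ (Fin.succ_injective _ e))

theorem frameDet_mem_right (a : Fin (m + 2) → ℝ) (K : Fin m → Fin (m + 2) → ℝ) (μ : Fin m) :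
    frameDet a (K μ) K = 0 := by
  refine AlternatingMap.map_eq_zero_of_eq _ _ (i := Fin.succ 0) (j := μ.succ.succ) rfl ?_
  exact fun e => Fin.succ_ne_zero _ (Fin.succ_injective _ e).symm

theorem twist_add (F F' : Fin (m + 2) → Fin (m + 2) → ℝ) (K : Fin m → Fin (m + 2) → ℝ) :
    twist (fun a b => F a b + F' a b) K = twist F K + twist F' K := by
  simp only [twist, add_mul, Finset.sum_add_distrib]

theorem twist_smul (r : ℝ) (F : Fin (m + 2) → Fin (m + 2) → ℝ) (K : Fin m → Fin (m + 2) → ℝ) :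
    twist (fun a b => r * F a b) K = r * twist F K := by
  simp only [twist, Finset.mul_sum, mul_assoc]

/-- The trace identity, contracted with a bivector. -/
theorem twist_derivation (F : Fin (m + 2) → Fin (m + 2) → ℝ) (K : Fin m → Fin (m + 2) → ℝ)
    (A : Matrix (Fin (m + 2)) (Fin (m + 2)) ℝ) :
    twist (fun a b => ∑ c, A a c * F c b + ∑ c, A b c * F a c - A.trace * F a b) K =
      - ∑ i, twist F (Function.update K i (A.mulVec (K i))) := by
  have hA : ∀ c, A.mulVec (Pi.single c 1) = fun a => A a c := fun c => by ext; simp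
  have h1 : twist (fun a b => ∑ c, A a c * F c b) K =
      ∑ a, ∑ b, F a b * frameDet (A.mulVec (Pi.single a 1)) (Pi.single b 1) K := by
    have : ∀ a b, F a b * frameDet (A.mulVec (Pi.single a 1)) (Pi.single b 1) K =
        ∑ c, A c a * F a b * frameDet (Pi.single c 1) (Pi.single b 1) K := by
      intro a b
      rw [frameDet_sum_left, hA, Finset.mul_sum]
      exact Finset.sum_congr rfl fun c _ => by ring
    simp only [twist, this, Finset.sum_mul]
    rw [Finset.sum_comm]
    conv_rhs => rw [Finset.sum_comm]
    refine Finset.sum_congr rfl fun b _ => ?_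
    rw [Finset.sum_comm]
  have h2 : twist (fun a b => ∑ c, A b c * F a c) K =
      ∑ a, ∑ b, F a b * frameDet (Pi.single a 1) (A.mulVec (Pi.single b 1)) K := by
    have : ∀ a b, F a b * frameDet (Pi.single a 1) (A.mulVec (Pi.single b 1)) K =
        ∑ c, A c b * F a b * frameDet (Pi.single a 1) (Pi.single c 1) K := by
      intro a b
      rw [frameDet_sum_right, hA, Finset.mul_sum]
      exact Finset.sum_congr rfl fun c _ => by ring
    simp only [twist, this, Finset.sum_mul]
    refine Finset.sum_congr rfl fun b _ => ?_
    rw [Finset.sum_comm]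
  have h3 : ∑ i, twist F (Function.update K i (A.mulVec (K i))) =
      ∑ a, ∑ b, F a b * ∑ i, frameDet (Pi.single a 1) (Pi.single b 1)
        (Function.update K i (A.mulVec (K i))) := by
    simp only [twist, Finset.mul_sum]
    rw [Finset.sum_comm]
    refine Finset.sum_congr rfl fun b _ => ?_
    rw [Finset.sum_comm]
  have h0 : twist (fun a b => ∑ c, A a c * F c b + ∑ c, A b c * F a c - A.trace * F a b) K =
      twist (fun a b => ∑ c, A a c * F c b) K + twist (fun a b => ∑ c, A b c * F a c) K -
        A.trace * twist F K := by
    simp only [sub_eq_add_neg, ← neg_mul]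
    rw [twist_add (fun a b => ∑ c, A a c * F c b + ∑ c, A b c * F a c)
      (fun a b => -A.trace * F a b), twist_add, twist_smul]
  rw [h0, h1, h2, h3]
  simp only [twist, Finset.mul_sum, ← Finset.sum_add_distrib, ← Finset.sum_sub_distrib,
    ← Finset.sum_neg_distrib]
  refine Finset.sum_congr rfl fun a _ => Finset.sum_congr rfl fun b _ => ?_
  have h := frameDet_trace (Pi.single a 1) (Pi.single b 1) K A
  simp only [← Finset.mul_sum, Finset.sum_neg_distrib]
  linear_combination F a b * h

/-- Cartan's formula for `d (i_{K₀} ⋯ i_{Kₘ₋₁} *F)`, pointwise: here `Φ` plays the role of the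
derivative `∂_c Fᵃᵇ` of a bivector density, and `A i` that of the derivative of `K i`. The last
three hypotheses say that this density is invariant under each `K i`, that the `K i` commute, and that its
divergence is proportional to one of the `K i`. -/
theorem twist_derivative_eq_zero (Φ : Fin (m + 2) → Fin (m + 2) → Fin (m + 2) → ℝ)
    (F : Fin (m + 2) → Fin (m + 2) → ℝ) (K : Fin m → Fin (m + 2) → ℝ)
    (A : Fin m → Matrix (Fin (m + 2)) (Fin (m + 2)) ℝ) (μ : Fin m) (r : ℝ)
    (hanti : ∀ c a b, Φ c a b = - Φ c b a)
    (hinv : ∀ i a b, ∑ c, K i c * Φ c a b =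
      ∑ c, A i a c * F c b + ∑ c, A i b c * F a c - (A i).trace * F a b)
    (hcomm : ∀ i j, (A i).mulVec (K j) = (A j).mulVec (K i))
    (hdiv : ∀ b, ∑ a, Φ a a b = r * K μ b) (w : Fin (m + 2) → ℝ) :
    twist (fun a b => ∑ c, w c * Φ c a b) K +
      ∑ i, twist F (Function.update K i ((A i).mulVec w)) = 0 := by
  have hdiv' : ∀ a, ∑ b, Φ b a b = -(r * K μ a) := by
    intro a
    rw [← hdiv, ← Finset.sum_neg_distrib]
    exact Finset.sum_congr rfl fun b _ => hanti _ _ _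
  -- Cramer's rule for the `m + 3` vectors `eₐ, e_b, K i, w`, contracted with `Φ`.
  have h1 : twist (fun a b => ∑ c, w c * Φ c a b) K =
      ∑ b, frameDet w (Pi.single b 1) K * ∑ a, Φ a a b +
      (∑ a, frameDet (Pi.single a 1) w K * ∑ b, Φ b a b +
      ∑ i, twist (fun a b => ∑ c, K i c * Φ c a b) (Function.update K i w)) := by
    have e1 : ∀ a b, (∑ c, w c * Φ c a b) * frameDet (Pi.single a 1) (Pi.single b 1) K =
        frameDet w (Pi.single b 1) K * Φ a a b +
        (frameDet (Pi.single a 1) w K * Φ b a b +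
        ∑ i, (∑ c, K i c * Φ c a b) *
          frameDet (Pi.single a 1) (Pi.single b 1) (Function.update K i w)) := by
      intro a b
      have e2 : ∀ c, w c * Φ c a b * frameDet (Pi.single a 1) (Pi.single b 1) K =
          frameDet w (Pi.single b 1) K * ((Pi.single a 1 : Fin (m + 2) → ℝ) c * Φ c a b) +
          (frameDet (Pi.single a 1) w K * ((Pi.single b 1 : Fin (m + 2) → ℝ) c * Φ c a b) +
          ∑ i, (K i c * Φ c a b) *
            frameDet (Pi.single a 1) (Pi.single b 1) (Function.update K i w)) := by
        intro c
        have h := frameDet_cramer (Pi.single a 1) (Pi.single b 1) w K c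
        have h' : ∑ i, (K i c * Φ c a b) *
            frameDet (Pi.single a 1) (Pi.single b 1) (Function.update K i w) =
            Φ c a b * ∑ i, frameDet (Pi.single a 1) (Pi.single b 1) (Function.update K i w) *
              K i c := by
          rw [Finset.mul_sum]
          exact Finset.sum_congr rfl fun i _ => by ring
        rw [h']
        linear_combination - Φ c a b * h
      rw [Finset.sum_mul, Finset.sum_congr rfl fun c _ => e2 c, Finset.sum_add_distrib,
        Finset.sum_add_distrib, ← Finset.mul_sum, ← Finset.mul_sum, Finset.sum_comm]
      simp only [Finset.sum_mul, Pi.single_apply, ite_mul, one_mul, zero_mul,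
        Finset.sum_ite_eq', Finset.mem_univ, if_true]
    simp only [twist, e1, Finset.sum_add_distrib, Finset.mul_sum]
    congr 1
    · exact Finset.sum_comm
    congr 1
    symm
    rw [Finset.sum_comm]
    exact Finset.sum_congr rfl fun a _ => Finset.sum_comm
  have h2 : ∑ b, frameDet w (Pi.single b 1) K * ∑ a, Φ a a b = 0 := by
    have e := frameDet_sum_right w (K μ) K
    rw [frameDet_mem_right] at e
    rw [← mul_zero r, e, Finset.mul_sum]
    refine Finset.sum_congr rfl fun b _ => ?_
    rw [hdiv]
    ring
  have h3 : ∑ a, frameDet (Pi.single a 1) w K * ∑ b, Φ b a b = 0 := by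
    have e := frameDet_sum_left (K μ) w K
    rw [frameDet_swap, frameDet_mem_right, neg_zero] at e
    rw [← mul_zero (-r), e, Finset.mul_sum]
    refine Finset.sum_congr rfl fun b _ => ?_
    rw [hdiv']
    ring
  -- The trace identity moves `A i` from `F` to the vectors of the frame.
  have h4 : ∀ i, twist (fun a b => ∑ c, K i c * Φ c a b) (Function.update K i w) =
      - ∑ j, twist F (Function.update (Function.update K i w) j
        ((A i).mulVec (Function.update K i w j))) := by
    intro i
    rw [← twist_derivation]
    congr 1
    ext a b
    exact hinv i a b
  -- The terms with `i ≠ j` cancel in pairs, because the `K i` commute.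
  have h5 : ∑ i, ∑ j, (if i = j then 0 else
      twist F (Function.update (Function.update K i w) j ((A i).mulVec (K j)))) = 0 := by
    set f : Fin m → Fin m → ℝ := fun i j => if i = j then 0 else
      twist F (Function.update (Function.update K i w) j ((A i).mulVec (K j))) with hf
    have hf' : ∀ i j, f i j = - f j i := by
      intro i j
      rcases eq_or_ne i j with rfl | h
      · simp [hf]
      · simp only [hf, if_neg h, if_neg h.symm, hcomm i j, twist]
        simp only [frameDet_swap_update _ _ w _ K h, mul_neg, Finset.sum_neg_distrib]
    have : ∑ i, ∑ j, f i j = - ∑ i, ∑ j, f i j := by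
      conv_lhs => rw [Finset.sum_comm]
      simp only [← Finset.sum_neg_distrib]
      exact Finset.sum_congr rfl fun i _ => Finset.sum_congr rfl fun j _ => hf' j i
    linarith
  have h6 : ∀ i, ∑ j, twist F (Function.update (Function.update K i w) j
        ((A i).mulVec (Function.update K i w j))) =
      twist F (Function.update K i ((A i).mulVec w)) + ∑ j, (if i = j then 0 else
      twist F (Function.update (Function.update K i w) j ((A i).mulVec (K j)))) := by
    intro i
    have e : twist F (Function.update K i ((A i).mulVec w)) = ∑ j, if i = j then
        twist F (Function.update K i ((A i).mulVec w)) else 0 := by simp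
    rw [e, ← Finset.sum_add_distrib]
    refine Finset.sum_congr rfl fun j _ => ?_
    rcases eq_or_ne i j with rfl | h
    · simp
    · simp [h, h.symm]
  rw [h1, h2, h3]
  simp only [h4, h6, Finset.sum_neg_distrib, Finset.sum_add_distrib, h5]
  ring

end Frames

/-! ### Calculus of partial derivatives -/

section Calculus

variable {d : ℕ} {U : Set (EuclideanSpace ℝ (Fin d))} {y : EuclideanSpace ℝ (Fin d)}

theorem differentiableAt_of_contDiffOn {F : EuclideanSpace ℝ (Fin d) → ℝ} (hU : IsOpen U)
    (hF : ContDiffOn ℝ ∞ F U) (hy : y ∈ U) : DifferentiableAt ℝ F y :=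
  ((hF y hy).contDiffAt (hU.mem_nhds hy)).differentiableAt (by simp)

theorem contDiffOn_pd {F : EuclideanSpace ℝ (Fin d) → ℝ} (hU : IsOpen U)
    (hF : ContDiffOn ℝ ∞ F U) (i : Fin d) : ContDiffOn ℝ ∞ (pd i F) U :=
  (hF.fderiv_of_isOpen hU (by simp)).clm_apply contDiffOn_const

theorem pd_comm {F : EuclideanSpace ℝ (Fin d) → ℝ} (hU : IsOpen U)
    (hF : ContDiffOn ℝ ∞ F U) (hy : y ∈ U) (i j : Fin d) :
    pd i (pd j F) y = pd j (pd i F) y := by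
  have hFy : ContDiffAt ℝ ∞ F y := (hF y hy).contDiffAt (hU.mem_nhds hy)
  have hs : IsSymmSndFDerivAt ℝ F y := hFy.isSymmSndFDerivAt (by
    rw [minSmoothness_of_isRCLikeNormedField]
    exact WithTop.coe_le_coe.2 le_top)
  have hd : DifferentiableAt ℝ (fderiv ℝ F) y :=
    (hFy.fderiv_right (m := ∞) (by simp)).differentiableAt (by simp)
  have h : ∀ a b : Fin d, pd a (pd b F) y = fderiv ℝ (fderiv ℝ F) y (basisVec a) (basisVec b) := by
    intro a b
    have : fderiv ℝ (pd b F) y = (fderiv ℝ (fderiv ℝ F) y).flip (basisVec b) := by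
      change fderiv ℝ (fun z => fderiv ℝ F z (basisVec b)) y = _
      rw [fderiv_clm_apply hd (differentiableAt_const _)]
      simp
    rw [pd, this]
    rfl
  rw [h, h, hs]

theorem pd_congr {F F' : EuclideanSpace ℝ (Fin d) → ℝ} (hU : IsOpen U) (hy : y ∈ U)
    (h : ∀ z ∈ U, F z = F' z) (i : Fin d) : pd i F y = pd i F' y := by
  have : F =ᶠ[nhds y] F' := Filter.eventuallyEq_of_mem (hU.mem_nhds hy) h
  rw [pd, pd, this.fderiv_eq]

theorem pd_zero (i : Fin d) : pd i (fun _ => (0 : ℝ)) y = 0 := by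
  simp [pd]

theorem pd_const (i : Fin d) (r : ℝ) : pd i (fun _ => r) y = 0 := by
  simp [pd]

theorem pd_add {F F' : EuclideanSpace ℝ (Fin d) → ℝ} (hF : DifferentiableAt ℝ F y)
    (hF' : DifferentiableAt ℝ F' y) (i : Fin d) :
    pd i (fun z => F z + F' z) y = pd i F y + pd i F' y := by
  rw [pd, fderiv_fun_add hF hF']
  rfl

theorem pd_sub {F F' : EuclideanSpace ℝ (Fin d) → ℝ} (hF : DifferentiableAt ℝ F y)
    (hF' : DifferentiableAt ℝ F' y) (i : Fin d) :
    pd i (fun z => F z - F' z) y = pd i F y - pd i F' y := by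
  rw [pd, fderiv_fun_sub hF hF']
  rfl

theorem pd_mul {F F' : EuclideanSpace ℝ (Fin d) → ℝ} (hF : DifferentiableAt ℝ F y)
    (hF' : DifferentiableAt ℝ F' y) (i : Fin d) :
    pd i (fun z => F z * F' z) y = F y * pd i F' y + pd i F y * F' y := by
  rw [pd, fderiv_fun_mul hF hF']
  simp only [pd, add_apply, smul_apply, smul_eq_mul]
  ring

theorem pd_const_mul {F : EuclideanSpace ℝ (Fin d) → ℝ} (hF : DifferentiableAt ℝ F y) (r : ℝ)
    (i : Fin d) : pd i (fun z => r * F z) y = r * pd i F y := by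
  rw [pd_mul (differentiableAt_const r) hF, pd_const]
  ring

theorem pd_sum {ι : Type*} {s : Finset ι} {F : ι → EuclideanSpace ℝ (Fin d) → ℝ}
    (hF : ∀ k ∈ s, DifferentiableAt ℝ (F k) y) (i : Fin d) :
    pd i (fun z => ∑ k ∈ s, F k z) y = ∑ k ∈ s, pd i (F k) y := by
  rw [pd, fderiv_fun_sum hF]
  simp [pd]

/-- The entrywise partial derivative of a matrix of functions. -/
def pdMat (k : Fin d) (N : EuclideanSpace ℝ (Fin d) → Matrix (Fin d) (Fin d) ℝ)
    (y : EuclideanSpace ℝ (Fin d)) : Matrix (Fin d) (Fin d) ℝ :=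
  Matrix.of fun i j => pd k (fun z => N z i j) y

/-- Smoothness on `U` of all entries of a matrix of functions. -/
def SmoothMatOn (U : Set (EuclideanSpace ℝ (Fin d)))
    (N : EuclideanSpace ℝ (Fin d) → Matrix (Fin d) (Fin d) ℝ) : Prop :=
  ∀ i j, ContDiffOn ℝ ∞ (fun y => N y i j) U

variable {N N' : EuclideanSpace ℝ (Fin d) → Matrix (Fin d) (Fin d) ℝ}

theorem SmoothMatOn.mul (hN : SmoothMatOn U N) (hN' : SmoothMatOn U N') :
    SmoothMatOn U (fun z => N z * N' z) := by
  intro i j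
  simp only [Matrix.mul_apply]
  exact ContDiffOn.sum fun k _ => (hN i k).mul (hN' k j)

theorem SmoothMatOn.det (hN : SmoothMatOn U N) : ContDiffOn ℝ ∞ (fun z => (N z).det) U := by
  simp only [Matrix.det_apply']
  exact ContDiffOn.sum fun σ _ => contDiffOn_const.mul (contDiffOn_prod fun i _ => hN _ _)

theorem SmoothMatOn.inv (hN : SmoothMatOn U N) (hdet : ∀ z ∈ U, (N z).det ≠ 0) :
    SmoothMatOn U (fun z => (N z)⁻¹) := by
  intro i j
  simp only [Matrix.inv_def, Matrix.smul_apply, Ring.inverse_eq_inv', smul_eq_mul]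
  refine (hN.det.inv hdet).mul ?_
  simp only [Matrix.adjugate_apply]
  refine SmoothMatOn.det (N := fun z => (N z).updateRow j (Pi.single i 1)) fun a b => ?_
  simp only [Matrix.updateRow_apply]
  split_ifs
  · exact contDiffOn_const
  · exact hN a b

theorem pdMat_mul (hU : IsOpen U) (hN : SmoothMatOn U N) (hN' : SmoothMatOn U N') (hy : y ∈ U)
    (k : Fin d) :
    pdMat k (fun z => N z * N' z) y = pdMat k N y * N' y + N y * pdMat k N' y := by
  ext i j
  simp only [pdMat, Matrix.of_apply, Matrix.add_apply, Matrix.mul_apply]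
  have h1 : ∀ a b, DifferentiableAt ℝ (fun z => N z a b) y :=
    fun a b => differentiableAt_of_contDiffOn hU (hN a b) hy
  have h2 : ∀ a b, DifferentiableAt ℝ (fun z => N' z a b) y :=
    fun a b => differentiableAt_of_contDiffOn hU (hN' a b) hy
  rw [pd_sum fun l _ => (h1 i l).fun_mul (h2 l j), ← Finset.sum_add_distrib]
  refine Finset.sum_congr rfl fun l _ => ?_
  rw [pd_mul (h1 i l) (h2 l j), add_comm]

theorem pdMat_congr (hU : IsOpen U) (hy : y ∈ U) (h : ∀ z ∈ U, N z = N' z) (k : Fin d) :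
    pdMat k N y = pdMat k N' y := by
  ext i j
  exact pd_congr hU hy (fun z hz => by rw [h z hz]) k

theorem pdMat_inv (hU : IsOpen U) (hN : SmoothMatOn U N) (hdet : ∀ z ∈ U, (N z).det ≠ 0)
    (hy : y ∈ U) (k : Fin d) :
    pdMat k (fun z => (N z)⁻¹) y = - ((N y)⁻¹ * pdMat k N y * (N y)⁻¹) := by
  have h := pdMat_mul hU hN (hN.inv hdet) hy k
  have h0 : pdMat k (fun z => N z * (N z)⁻¹) y = 0 := by
    rw [pdMat_congr (N' := fun _ => 1) hU hy fun z hz =>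
      Matrix.mul_nonsing_inv _ (isUnit_iff_ne_zero.2 (hdet z hz))]
    ext i j
    exact pd_const k _
  rw [h0] at h
  have h1 : (N y)⁻¹ * N y = 1 := Matrix.nonsing_inv_mul _ (isUnit_iff_ne_zero.2 (hdet y hy))
  calc pdMat k (fun z => (N z)⁻¹) y = (N y)⁻¹ * (N y * pdMat k (fun z => (N z)⁻¹) y) := by
        rw [← Matrix.mul_assoc, h1, Matrix.one_mul]
    _ = (N y)⁻¹ * (- (pdMat k N y * (N y)⁻¹)) := by
        rw [eq_neg_of_add_eq_zero_right h.symm]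
    _ = _ := by rw [Matrix.mul_neg, Matrix.mul_assoc]

end Calculus

/-! ### Killing fields in local coordinates -/

section Coordinates

variable {d : ℕ} {U : Set (EuclideanSpace ℝ (Fin d))} {y : EuclideanSpace ℝ (Fin d)}
  {G : EuclideanSpace ℝ (Fin d) → Matrix (Fin d) (Fin d) ℝ}
  {X Y : Fin d → EuclideanSpace ℝ (Fin d) → ℝ}

/-- The matrix `(Γᵏ)ᵃ_b = Γᵃₖ_b` of the Levi-Civita connection in the direction `∂ₖ`. -/
def connMat (G : EuclideanSpace ℝ (Fin d) → Matrix (Fin d) (Fin d) ℝ) (k : Fin d)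
    (y : EuclideanSpace ℝ (Fin d)) : Matrix (Fin d) (Fin d) ℝ :=
  Matrix.of fun a b => christoffel G a k b y

/-- The matrix `Aᵏᵢ = ∂ᵢ Xᵏ`. -/
def jacobian (X : Fin d → EuclideanSpace ℝ (Fin d) → ℝ) (y : EuclideanSpace ℝ (Fin d)) :
    Matrix (Fin d) (Fin d) ℝ :=
  Matrix.of fun k i => pd i (X k) y

/-- The covector `ξⱼ = gⱼₖ Xᵏ`. -/
def lower (G : EuclideanSpace ℝ (Fin d) → Matrix (Fin d) (Fin d) ℝ)
    (X : Fin d → EuclideanSpace ℝ (Fin d) → ℝ) (j : Fin d) (y : EuclideanSpace ℝ (Fin d)) : ℝ :=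
  ∑ k, G y j k * X k y

/-- The exterior derivative `Wᵢⱼ = ∂ᵢ ξⱼ - ∂ⱼ ξᵢ` of the covector `ξ` associated with `X`. -/
def curl (G : EuclideanSpace ℝ (Fin d) → Matrix (Fin d) (Fin d) ℝ)
    (X : Fin d → EuclideanSpace ℝ (Fin d) → ℝ) (y : EuclideanSpace ℝ (Fin d)) :
    Matrix (Fin d) (Fin d) ℝ :=
  Matrix.of fun i j => pd i (lower G X j) y - pd j (lower G X i) y

/-- The bivector obtained by raising both indices of `curl G X`. -/
def curlUp (G : EuclideanSpace ℝ (Fin d) → Matrix (Fin d) (Fin d) ℝ)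
    (X : Fin d → EuclideanSpace ℝ (Fin d) → ℝ) (y : EuclideanSpace ℝ (Fin d)) :
    Matrix (Fin d) (Fin d) ℝ :=
  (G y)⁻¹ * curl G X y * (G y)⁻¹

/-- The covariant derivative `Bᵏⱼ = ∇ⱼ Xᵏ`. -/
def covDeriv (G : EuclideanSpace ℝ (Fin d) → Matrix (Fin d) (Fin d) ℝ)
    (X : Fin d → EuclideanSpace ℝ (Fin d) → ℝ) (y : EuclideanSpace ℝ (Fin d)) :
    Matrix (Fin d) (Fin d) ℝ :=
  jacobian X y + ∑ l, X l y • connMat G l y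

/-- Nondegenerate symmetric metric coefficients, smooth on an open set `U`. -/
structure IsMetricOn (U : Set (EuclideanSpace ℝ (Fin d)))
    (G : EuclideanSpace ℝ (Fin d) → Matrix (Fin d) (Fin d) ℝ) : Prop where
  isOpen : IsOpen U
  smooth : SmoothMatOn U G
  symm : ∀ z, (G z).transpose = G z
  det_ne_zero : ∀ z ∈ U, (G z).det ≠ 0

/-- The components of a smooth Killing field on `U`, with Killing's equation in matrix form. -/
structure IsKillingOn (U : Set (EuclideanSpace ℝ (Fin d)))
    (G : EuclideanSpace ℝ (Fin d) → Matrix (Fin d) (Fin d) ℝ)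
    (X : Fin d → EuclideanSpace ℝ (Fin d) → ℝ) : Prop where
  smooth : ∀ k, ContDiffOn ℝ ∞ (X k) U
  killing : ∀ z ∈ U, ∑ k, X k z • pdMat k G z + (jacobian X z).transpose * G z +
    G z * jacobian X z = 0

namespace IsMetricOn

variable (hG : IsMetricOn U G)
include hG

theorem inv_mul (hy : y ∈ U) : (G y)⁻¹ * G y = 1 :=
  Matrix.nonsing_inv_mul _ (isUnit_iff_ne_zero.2 (hG.det_ne_zero y hy))

theorem mul_inv (hy : y ∈ U) : G y * (G y)⁻¹ = 1 :=
  Matrix.mul_nonsing_inv _ (isUnit_iff_ne_zero.2 (hG.det_ne_zero y hy))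

theorem inv_symm (y : EuclideanSpace ℝ (Fin d)) : ((G y)⁻¹).transpose = (G y)⁻¹ := by
  rw [Matrix.transpose_nonsing_inv, hG.symm]

end IsMetricOn
end Coordinates

section Coordinates

variable {d : ℕ} {U : Set (EuclideanSpace ℝ (Fin d))} {y : EuclideanSpace ℝ (Fin d)}
  {G : EuclideanSpace ℝ (Fin d) → Matrix (Fin d) (Fin d) ℝ}
  {X Y : Fin d → EuclideanSpace ℝ (Fin d) → ℝ}

namespace IsMetricOn

variable (hG : IsMetricOn U G)
include hG

theorem smooth_inv : SmoothMatOn U (fun z => (G z)⁻¹) := hG.smooth.inv hG.det_ne_zero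

theorem symm_apply (z : EuclideanSpace ℝ (Fin d)) (i j : Fin d) : G z i j = G z j i :=
  congrFun (congrFun (hG.symm z) j) i

theorem christoffel_symm (k i j : Fin d) (z : EuclideanSpace ℝ (Fin d)) :
    christoffel G k i j z = christoffel G k j i z := by
  simp only [christoffel]
  congr 1
  refine Finset.sum_congr rfl fun l _ => ?_
  have : (fun z => G z i j) = fun z => G z j i := funext fun z => hG.symm_apply z i j
  rw [this]
  ring

theorem contDiffOn_christoffel (k i j : Fin d) : ContDiffOn ℝ ∞ (christoffel G k i j) U := by
  refine contDiffOn_const.mul (ContDiffOn.sum fun l _ => (hG.smooth_inv k l).mul ?_)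
  exact ((contDiffOn_pd hG.isOpen (hG.smooth _ _) _).add
    (contDiffOn_pd hG.isOpen (hG.smooth _ _) _)).sub (contDiffOn_pd hG.isOpen (hG.smooth _ _) _)

theorem pd_symm (k i j : Fin d) (z : EuclideanSpace ℝ (Fin d)) :
    pd k (fun z => G z i j) z = pd k (fun z => G z j i) z := by
  have : (fun z => G z i j) = fun z => G z j i := funext fun z => hG.symm_apply z i j
  rw [this]

/-- The Christoffel symbols of the first kind. -/
theorem mul_connMat (hy : y ∈ U) (k i j : Fin d) :
    (G y * connMat G k y) i j = (1 / 2) * (pd k (fun z => G z j i) y +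
      pd j (fun z => G z k i) y - pd i (fun z => G z k j) y) := by
  set v : Fin d → ℝ := fun l => (1 / 2) * (pd k (fun z => G z j l) y +
      pd j (fun z => G z k l) y - pd l (fun z => G z k j) y) with hv
  have h : (fun a => connMat G k y a j) = (G y)⁻¹.mulVec v := by
    ext a
    simp only [connMat, christoffel, Matrix.of_apply, Matrix.mulVec, dotProduct, hv,
      Finset.mul_sum]
    exact Finset.sum_congr rfl fun l _ => by ring
  have h2 : (G y * connMat G k y) i j = (G y).mulVec (fun a => connMat G k y a j) i := rfl
  rw [h2, h, Matrix.mulVec_mulVec, hG.mul_inv hy, Matrix.one_mulVec]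

/-- The Levi-Civita connection is metric. -/
theorem pdMat_eq (hy : y ∈ U) (k : Fin d) :
    pdMat k G y = G y * connMat G k y + (G y * connMat G k y).transpose := by
  ext i j
  rw [Matrix.add_apply, Matrix.transpose_apply, hG.mul_connMat hy, hG.mul_connMat hy,
    hG.pd_symm k j i, hG.pd_symm i k j, hG.pd_symm j k i, hG.pd_symm j i k, hG.pd_symm i j k]
  simp only [pdMat, Matrix.of_apply]
  ring

theorem pdMat_inv_eq (hy : y ∈ U) (k : Fin d) :
    pdMat k (fun z => (G z)⁻¹) y =
      - (connMat G k y * (G y)⁻¹ + (G y)⁻¹ * (connMat G k y).transpose) := by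
  rw [pdMat_inv hG.isOpen hG.smooth hG.det_ne_zero hy, hG.pdMat_eq hy, Matrix.transpose_mul,
    hG.symm, Matrix.mul_add, Matrix.add_mul, ← Matrix.mul_assoc, hG.inv_mul hy, Matrix.one_mul,
    Matrix.mul_assoc, Matrix.mul_assoc, hG.mul_inv hy, Matrix.mul_one]

theorem trace_inv_mul_pdMat (hy : y ∈ U) (k : Fin d) :
    ((G y)⁻¹ * pdMat k G y).trace = 2 * (connMat G k y).trace := by
  rw [hG.pdMat_eq hy, Matrix.mul_add, Matrix.trace_add, ← Matrix.mul_assoc, hG.inv_mul hy,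
    Matrix.one_mul, Matrix.transpose_mul, hG.symm, Matrix.trace_mul_comm, Matrix.mul_assoc,
    hG.mul_inv hy, Matrix.mul_one, Matrix.trace_transpose]
  ring

/-- A Killing field is divergence free. -/
theorem trace_jacobian (hX : IsKillingOn U G X) (hy : y ∈ U) :
    (jacobian X y).trace = - ∑ k, X k y * (connMat G k y).trace := by
  have h := congrArg (fun N => ((G y)⁻¹ * N).trace) (hX.killing y hy)
  simp only [Matrix.mul_add, Matrix.trace_add, Matrix.mul_zero, Matrix.trace_zero,
    Matrix.mul_sum, Matrix.trace_sum, Matrix.mul_smul, Matrix.trace_smul, smul_eq_mul,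
    hG.trace_inv_mul_pdMat hy] at h
  rw [← Matrix.mul_assoc (G y)⁻¹ (G y), hG.inv_mul hy, Matrix.one_mul,
    Matrix.trace_mul_comm (G y)⁻¹, Matrix.mul_assoc, hG.mul_inv hy, Matrix.mul_one,
    Matrix.trace_transpose] at h
  have e : ∑ k, X k y * (2 * (connMat G k y).trace) = 2 * ∑ k, X k y * (connMat G k y).trace := by
    rw [Finset.mul_sum]
    exact Finset.sum_congr rfl fun k _ => by ring
  rw [e] at h
  linarith

/-- The inverse metric is invariant under a Killing field. -/
theorem sum_smul_pdMat_inv (hY : IsKillingOn U G Y) (hy : y ∈ U) :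
    ∑ c, Y c y • pdMat c (fun z => (G z)⁻¹) y =
      jacobian Y y * (G y)⁻¹ + (G y)⁻¹ * (jacobian Y y).transpose := by
  have h1 : ∑ c, Y c y • pdMat c (fun z => (G z)⁻¹) y =
      - ((G y)⁻¹ * (∑ c, Y c y • pdMat c G y) * (G y)⁻¹) := by
    simp only [pdMat_inv hG.isOpen hG.smooth hG.det_ne_zero hy, Matrix.mul_sum, Matrix.sum_mul,
      Matrix.mul_smul, Matrix.smul_mul, smul_neg, Finset.sum_neg_distrib]
  have h2 : ∑ c, Y c y • pdMat c G y =
      - ((jacobian Y y).transpose * G y) - G y * jacobian Y y := by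
    have := hY.killing y hy
    rw [add_assoc] at this
    rw [eq_neg_of_add_eq_zero_left this]
    abel
  rw [h1, h2, Matrix.mul_sub, Matrix.sub_mul, Matrix.mul_neg, Matrix.neg_mul,
    ← Matrix.mul_assoc (G y)⁻¹ (G y), hG.inv_mul hy, Matrix.one_mul, Matrix.mul_assoc (G y)⁻¹,
    Matrix.mul_assoc _ (G y), hG.mul_inv hy, Matrix.mul_one]
  abel

theorem contDiffOn_lower (hX : ∀ k, ContDiffOn ℝ ∞ (X k) U) (j : Fin d) :
    ContDiffOn ℝ ∞ (lower G X j) U :=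
  ContDiffOn.sum fun k _ => (hG.smooth j k).mul (hX k)

theorem smooth_curl (hX : ∀ k, ContDiffOn ℝ ∞ (X k) U) : SmoothMatOn U (curl G X) :=
  fun _ _ => (contDiffOn_pd hG.isOpen (hG.contDiffOn_lower hX _) _).sub
    (contDiffOn_pd hG.isOpen (hG.contDiffOn_lower hX _) _)

theorem smooth_curlUp (hX : ∀ k, ContDiffOn ℝ ∞ (X k) U) : SmoothMatOn U (curlUp G X) :=
  (hG.smooth_inv.mul (hG.smooth_curl hX)).mul hG.smooth_inv

/-- The product rule for `ξⱼ = gⱼₖ Xᵏ`. -/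
theorem pd_lower (hX : ∀ k, ContDiffOn ℝ ∞ (X k) U) (hy : y ∈ U) (c j : Fin d) :
    pd c (lower G X j) y = ∑ k, pdMat c G y j k * X k y + (G y * jacobian X y) j c := by
  have h1 : ∀ a b, DifferentiableAt ℝ (fun z => G z a b) y :=
    fun a b => differentiableAt_of_contDiffOn hG.isOpen (hG.smooth a b) hy
  have h2 : ∀ a, DifferentiableAt ℝ (X a) y :=
    fun a => differentiableAt_of_contDiffOn hG.isOpen (hX a) hy
  change pd c (fun z => ∑ k, G z j k * X k z) y = _
  rw [pd_sum fun l _ => (h1 j l).fun_mul (h2 l), Matrix.mul_apply, ← Finset.sum_add_distrib]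
  refine Finset.sum_congr rfl fun l _ => ?_
  rw [pd_mul (h1 j l) (h2 l), add_comm]
  rfl

/-- If a Killing field `Y` commutes with `X`, the covector associated with `X` is invariant
under `Y`. -/
theorem lieDeriv_lower (hX : ∀ k, ContDiffOn ℝ ∞ (X k) U) (hY : IsKillingOn U G Y)
    (hcomm : ∀ z ∈ U, (jacobian X z).mulVec (fun k => Y k z) =
      (jacobian Y z).mulVec (fun k => X k z)) (hy : y ∈ U) (j : Fin d) :
    ∑ c, Y c y * pd c (lower G X j) y + ∑ c, lower G X c y * pd j (Y c) y = 0 := by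
  have h1 : ∑ c, Y c y * pd c (lower G X j) y =
      ∑ k, (∑ c, Y c y • pdMat c G y) j k * X k y +
        ((G y * jacobian X y).mulVec fun k => Y k y) j := by
    simp only [hG.pd_lower hX hy, mul_add, Finset.sum_add_distrib]
    congr 1
    · simp only [Matrix.sum_apply, Matrix.smul_apply, smul_eq_mul, Finset.sum_mul, Finset.mul_sum]
      rw [Finset.sum_comm]
      exact Finset.sum_congr rfl fun _ _ => Finset.sum_congr rfl fun _ _ => by ring
    · exact Finset.sum_congr rfl fun _ _ => mul_comm _ _
  have h2 : ∑ c, lower G X c y * pd j (Y c) y =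
      (((jacobian Y y).transpose * G y).mulVec fun k => X k y) j := by
    rw [← Matrix.mulVec_mulVec]
    exact Finset.sum_congr rfl fun _ _ => mul_comm _ _
  have h3 : ((G y * jacobian X y).mulVec fun k => Y k y) =
      (G y * jacobian Y y).mulVec fun k => X k y := by
    rw [← Matrix.mulVec_mulVec, hcomm y hy, Matrix.mulVec_mulVec]
  have h4 := congrFun (congrArg (fun N => Matrix.mulVec N fun k => X k y) (hY.killing y hy)) j
  simp only [Matrix.add_mulVec, Matrix.zero_mulVec, Pi.add_apply, Pi.zero_apply] at h4
  rw [h1, h2, h3]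
  rw [← h4]
  simp only [Matrix.mulVec, dotProduct]
  ring

/-- If a Killing field `Y` commutes with `X`, the exterior derivative of the covector associated
with `X` is invariant under `Y`. -/
theorem sum_smul_pdMat_curl (hX : ∀ k, ContDiffOn ℝ ∞ (X k) U) (hY : IsKillingOn U G Y)
    (hcomm : ∀ z ∈ U, (jacobian X z).mulVec (fun k => Y k z) =
      (jacobian Y z).mulVec (fun k => X k z)) (hy : y ∈ U) :
    ∑ c, Y c y • pdMat c (curl G X) y =
      - ((jacobian Y y).transpose * curl G X y + curl G X y * jacobian Y y) := by
  have hU := hG.isOpen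
  have hL := fun j => hG.contDiffOn_lower hX j
  have dL : ∀ j, DifferentiableAt ℝ (lower G X j) y :=
    fun j => differentiableAt_of_contDiffOn hU (hL j) hy
  have dpL : ∀ i j, DifferentiableAt ℝ (pd i (lower G X j)) y :=
    fun i j => differentiableAt_of_contDiffOn hU (contDiffOn_pd hU (hL j) i) hy
  have dY : ∀ j, DifferentiableAt ℝ (Y j) y :=
    fun j => differentiableAt_of_contDiffOn hU (hY.smooth j) hy
  have dpY : ∀ i j, DifferentiableAt ℝ (pd i (Y j)) y :=
    fun i j => differentiableAt_of_contDiffOn hU (contDiffOn_pd hU (hY.smooth j) i) hy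
  have key : ∀ i j, ∑ c, (Y c y * pd i (pd c (lower G X j)) y +
      pd i (Y c) y * pd c (lower G X j) y) +
      ∑ c, (lower G X c y * pd i (pd j (Y c)) y + pd i (lower G X c) y * pd j (Y c) y) = 0 := by
    intro i j
    have h := pd_congr hU hy (fun z hz => hG.lieDeriv_lower hX hY hcomm hz j) i
    rw [pd_zero, pd_add (DifferentiableAt.fun_sum fun c _ => (dY c).fun_mul (dpL c j))
      (DifferentiableAt.fun_sum fun c _ => (dL c).fun_mul (dpY j c)),
      pd_sum fun c _ => (dY c).fun_mul (dpL c j), pd_sum fun c _ => (dL c).fun_mul (dpY j c)] at h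
    rw [← h]
    congr 1
    · exact Finset.sum_congr rfl fun c _ => (pd_mul (dY c) (dpL c j) i).symm
    · exact Finset.sum_congr rfl fun c _ => (pd_mul (dL c) (dpY j c) i).symm
  ext i j
  have hij := key i j
  have hji := key j i
  have e : ∀ c, pdMat c (curl G X) y i j =
      pd i (pd c (lower G X j)) y - pd j (pd c (lower G X i)) y := by
    intro c
    rw [pd_comm hU (hL j) hy i c, pd_comm hU (hL i) hy j c, ← pd_sub (dpL i j) (dpL j i)]
    rfl
  simp only [Matrix.sum_apply, Matrix.smul_apply, smul_eq_mul, e, Matrix.neg_apply,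
    Matrix.add_apply, Matrix.mul_apply, Matrix.transpose_apply, jacobian, curl, Matrix.of_apply]
  simp only [pd_comm hU (hY.smooth _) hy j i] at hji
  rw [← sub_eq_zero, ← Finset.sum_add_distrib, ← Finset.sum_neg_distrib,
    ← Finset.sum_sub_distrib]
  rw [← Finset.sum_add_distrib] at hij hji
  rw [← sub_eq_zero.2 (hij.trans hji.symm), ← Finset.sum_sub_distrib]
  exact Finset.sum_congr rfl fun c _ => by ring

/-- If a Killing field `Y` commutes with `X`, the bivector `curlUp G X` is invariant under `Y`. -/
theorem sum_smul_pdMat_curlUp (hX : ∀ k, ContDiffOn ℝ ∞ (X k) U) (hY : IsKillingOn U G Y)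
    (hcomm : ∀ z ∈ U, (jacobian X z).mulVec (fun k => Y k z) =
      (jacobian Y z).mulVec (fun k => X k z)) (hy : y ∈ U) :
    ∑ c, Y c y • pdMat c (curlUp G X) y =
      jacobian Y y * curlUp G X y + curlUp G X y * (jacobian Y y).transpose := by
  have h0 : ∀ c, pdMat c (curlUp G X) y =
      pdMat c (fun z => (G z)⁻¹) y * (curl G X y * (G y)⁻¹) +
      (G y)⁻¹ * pdMat c (curl G X) y * (G y)⁻¹ +
      (G y)⁻¹ * curl G X y * pdMat c (fun z => (G z)⁻¹) y := by
    intro c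
    have := pdMat_mul hG.isOpen (hG.smooth_inv.mul (hG.smooth_curl hX)) hG.smooth_inv hy c
    rw [pdMat_mul hG.isOpen hG.smooth_inv (hG.smooth_curl hX) hy c, Matrix.add_mul,
      Matrix.mul_assoc] at this
    exact this
  have h1 : ∑ c, Y c y • pdMat c (curlUp G X) y =
      (∑ c, Y c y • pdMat c (fun z => (G z)⁻¹) y) * (curl G X y * (G y)⁻¹) +
      (G y)⁻¹ * (∑ c, Y c y • pdMat c (curl G X) y) * (G y)⁻¹ +
      (G y)⁻¹ * curl G X y * (∑ c, Y c y • pdMat c (fun z => (G z)⁻¹) y) := by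
    simp only [h0, smul_add, Finset.sum_add_distrib, Matrix.mul_sum, Matrix.sum_mul,
      Matrix.mul_smul, Matrix.smul_mul]
  rw [h1, hG.sum_smul_pdMat_inv hY hy, hG.sum_smul_pdMat_curl hX hY hcomm hy, curlUp]
  noncomm_ring

end IsMetricOn
end Coordinates

/-! ### The divergence of the exterior derivative of a Killing covector -/

section Coordinates

variable {d : ℕ} {U : Set (EuclideanSpace ℝ (Fin d))} {y : EuclideanSpace ℝ (Fin d)}
  {G : EuclideanSpace ℝ (Fin d) → Matrix (Fin d) (Fin d) ℝ}
  {X Y : Fin d → EuclideanSpace ℝ (Fin d) → ℝ}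

namespace IsMetricOn

variable (hG : IsMetricOn U G)
include hG

omit hG in
theorem covDeriv_apply (a j : Fin d) (z : EuclideanSpace ℝ (Fin d)) :
    covDeriv G X z a j = pd j (X a) z + ∑ l, christoffel G a l j z * X l z := by
  simp only [covDeriv, Matrix.add_apply, Matrix.sum_apply, Matrix.smul_apply, smul_eq_mul,
    jacobian, connMat, Matrix.of_apply]
  congr 1
  exact Finset.sum_congr rfl fun _ _ => mul_comm _ _

theorem smooth_covDeriv (hX : ∀ k, ContDiffOn ℝ ∞ (X k) U) : SmoothMatOn U (covDeriv G X) := by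
  intro a j
  simp only [covDeriv_apply]
  exact (contDiffOn_pd hG.isOpen (hX a) j).add
    (ContDiffOn.sum fun l _ => (hG.contDiffOn_christoffel a l j).mul (hX l))

/-- The contracted Ricci identity `∇ₐ ∇ⱼ Xᵃ = Rⱼₗ Xˡ` for divergence free fields. -/
theorem div_covDeriv (hX : ∀ k, ContDiffOn ℝ ∞ (X k) U)
    (htr : ∀ z ∈ U, (covDeriv G X z).trace = 0) (hy : y ∈ U) (j : Fin d) :
    ∑ a, (pd a (fun z => covDeriv G X z a j) y + (connMat G a y).trace * covDeriv G X y a j) -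
      ∑ a, ∑ c, covDeriv G X y a c * christoffel G c a j y =
      ∑ l, ricciCoeff G l j y * X l y := by
  have hU := hG.isOpen
  have dX : ∀ a, DifferentiableAt ℝ (X a) y :=
    fun a => differentiableAt_of_contDiffOn hU (hX a) hy
  have dpX : ∀ i a, DifferentiableAt ℝ (pd i (X a)) y :=
    fun i a => differentiableAt_of_contDiffOn hU (contDiffOn_pd hU (hX a) i) hy
  have dC : ∀ a b c, DifferentiableAt ℝ (christoffel G a b c) y :=
    fun a b c => differentiableAt_of_contDiffOn hU (hG.contDiffOn_christoffel a b c) hy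
  have hp : ∀ i a k, pd i (fun z => covDeriv G X z a k) y = pd i (pd k (X a)) y +
      ∑ l, (christoffel G a l k y * pd i (X l) y + pd i (christoffel G a l k) y * X l y) := by
    intro i a k
    simp only [covDeriv_apply]
    rw [pd_add (dpX k a) (DifferentiableAt.fun_sum fun l _ => (dC a l k).fun_mul (dX l)),
      pd_sum fun l _ => (dC a l k).fun_mul (dX l)]
    congr 1
    exact Finset.sum_congr rfl fun l _ => pd_mul (dC a l k) (dX l) i
  -- The derivative of the vanishing divergence.
  have h0 : ∑ a, (pd a (pd j (X a)) y +
      ∑ l, (christoffel G a l a y * pd j (X l) y + pd j (christoffel G a l a) y * X l y)) = 0 := by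
    have h := pd_congr hU hy htr j
    have hd : ∀ a, DifferentiableAt ℝ (fun z => covDeriv G X z a a) y :=
      fun a => differentiableAt_of_contDiffOn hU (hG.smooth_covDeriv hX a a) hy
    rw [pd_zero] at h
    simp only [Matrix.trace, Matrix.diag_apply] at h
    rw [pd_sum fun a _ => hd a] at h
    rw [← h]
    exact Finset.sum_congr rfl fun a _ => by rw [hp, pd_comm hU (hX a) hy]
  -- The terms that are linear in `∂X` in `e1` and `e2` cancel against those of `hp` and `h0`; the
  -- rest is the Ricci tensor `e3`.
  have e1 : ∑ a, (connMat G a y).trace * covDeriv G X y a j =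
      ∑ a, ∑ l, christoffel G a l a y * pd j (X l) y +
      ∑ l, ∑ k, ∑ p, christoffel G k k p y * christoffel G p l j y * X l y := by
    have : ∀ a, (connMat G a y).trace * covDeriv G X y a j =
        ∑ k, christoffel G k a k y * pd j (X a) y +
        ∑ l, ∑ k, christoffel G k k a y * christoffel G a l j y * X l y := by
      intro a
      rw [covDeriv_apply, mul_add]
      simp only [Matrix.trace, Matrix.diag_apply, connMat, Matrix.of_apply, Finset.sum_mul,
        Finset.mul_sum]
      congr 1
      refine Finset.sum_congr rfl fun l _ => Finset.sum_congr rfl fun k _ => ?_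
      rw [hG.christoffel_symm k a k]
      ring
    simp only [this, Finset.sum_add_distrib]
    congr 1
    · exact Finset.sum_comm
    · rw [Finset.sum_comm]
      exact Finset.sum_congr rfl fun l _ => Finset.sum_comm
  have e2 : ∑ a, ∑ c, covDeriv G X y a c * christoffel G c a j y =
      ∑ a, ∑ l, christoffel G a l j y * pd a (X l) y +
      ∑ l, ∑ k, ∑ p, christoffel G k j p y * christoffel G p l k y * X l y := by
    simp only [covDeriv_apply, add_mul, Finset.sum_add_distrib]
    congr 1
    · rw [Finset.sum_comm]
      exact Finset.sum_congr rfl fun _ _ => Finset.sum_congr rfl fun _ _ => mul_comm _ _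
    · simp only [Finset.sum_mul]
      calc _ = ∑ a, ∑ l, ∑ c, christoffel G a l c y * X l y * christoffel G c a j y :=
            Finset.sum_congr rfl fun a _ => Finset.sum_comm
        _ = ∑ l, ∑ a, ∑ c, christoffel G a l c y * X l y * christoffel G c a j y :=
            Finset.sum_comm
        _ = ∑ l, ∑ c, ∑ a, christoffel G a l c y * X l y * christoffel G c a j y :=
            Finset.sum_congr rfl fun a _ => Finset.sum_comm
        _ = _ := by
          refine Finset.sum_congr rfl fun _ _ => Finset.sum_congr rfl fun c _ =>
            Finset.sum_congr rfl fun a _ => ?_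
          rw [hG.christoffel_symm c a j]
          ring
  have e3 : ∑ l, ricciCoeff G l j y * X l y =
      ∑ a, ∑ l, pd a (christoffel G a l j) y * X l y -
      ∑ a, ∑ l, pd j (christoffel G a l a) y * X l y +
      (∑ l, ∑ k, ∑ p, christoffel G k k p y * christoffel G p l j y * X l y -
      ∑ l, ∑ k, ∑ p, christoffel G k j p y * christoffel G p l k y * X l y) := by
    have : ∀ l, ricciCoeff G l j y * X l y =
        ∑ a, pd a (christoffel G a l j) y * X l y - ∑ a, pd j (christoffel G a l a) y * X l y +
        (∑ k, ∑ p, christoffel G k k p y * christoffel G p l j y * X l y -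
        ∑ k, ∑ p, christoffel G k j p y * christoffel G p l k y * X l y) := by
      intro l
      rw [ricciCoeff, add_mul]
      simp only [← Finset.sum_mul, ← Finset.sum_sub_distrib, ← sub_mul]
    simp only [this, Finset.sum_add_distrib, Finset.sum_sub_distrib]
    rw [Finset.sum_comm (f := fun l a => pd a (christoffel G a l j) y * X l y),
      Finset.sum_comm (f := fun l a => pd j (christoffel G a l a) y * X l y)]
  rw [Finset.sum_add_distrib, e1, e2, e3]
  simp only [hp]
  simp only [Finset.sum_add_distrib] at h0 ⊢
  generalize ∑ a, pd a (pd j (X a)) y = s₁ at h0 ⊢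
  generalize ∑ a, ∑ l, christoffel G a l a y * pd j (X l) y = s₂ at h0 ⊢
  generalize ∑ a, ∑ l, pd j (christoffel G a l a) y * X l y = s₃ at h0 ⊢
  generalize ∑ a, ∑ l, christoffel G a l j y * pd a (X l) y = s₄
  generalize ∑ a, ∑ l, pd a (christoffel G a l j) y * X l y = s₅
  generalize ∑ l, ∑ k, ∑ p, christoffel G k k p y * christoffel G p l j y * X l y = s₆
  generalize ∑ l, ∑ k, ∑ p, christoffel G k j p y * christoffel G p l k y * X l y = s₇
  linarith

/-- Killing's equation in covariant form: `∇ᵢ Xⱼ` is antisymmetric. -/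
theorem mul_covDeriv_add_transpose (hX : IsKillingOn U G X) (hy : y ∈ U) :
    G y * covDeriv G X y + (G y * covDeriv G X y).transpose = 0 := by
  rw [← hX.killing y hy]
  simp only [covDeriv, hG.pdMat_eq hy, smul_add, Finset.sum_add_distrib, Matrix.mul_add,
    Matrix.mul_sum, Matrix.mul_smul, Matrix.transpose_add, Matrix.transpose_sum,
    Matrix.transpose_smul, Matrix.transpose_mul, hG.symm]
  abel

/-- The exterior derivative of a Killing covector is twice its covariant derivative. -/
theorem curl_eq (hX : IsKillingOn U G X) (hy : y ∈ U) :
    curl G X y = (-2 : ℝ) • (G y * covDeriv G X y) := by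
  have h1 : ∀ i j, pd i (lower G X j) y =
      (G y * covDeriv G X y) j i + ∑ k, (G y * connMat G i y) k j * X k y := by
    intro i j
    have h2 : ∀ k, (G y * connMat G i y) j k = (G y * connMat G k y) j i := by
      intro k
      rw [hG.mul_connMat hy, hG.mul_connMat hy, hG.pd_symm i k j, hG.pd_symm k i j]
      have : (fun z => G z i k) = fun z => G z k i := funext fun z => hG.symm_apply z i k
      rw [this]
      ring
    rw [hG.pd_lower hX.smooth hy, hG.pdMat_eq hy]
    simp only [Matrix.add_apply, Matrix.transpose_apply, add_mul, Finset.sum_add_distrib, h2,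
      covDeriv, Matrix.mul_add, Matrix.mul_sum, Matrix.mul_smul, Matrix.sum_apply,
      Matrix.smul_apply, smul_eq_mul]
    have : ∑ x, (G y * connMat G x y) j i * X x y = ∑ x, X x y * (G y * connMat G x y) j i :=
      Finset.sum_congr rfl fun _ _ => mul_comm _ _
    rw [this]
    ring
  have h3 : ∀ i j k, (G y * connMat G i y) k j = (G y * connMat G j y) k i := by
    intro i j k
    rw [hG.mul_connMat hy, hG.mul_connMat hy]
    have : (fun z => G z i j) = fun z => G z j i := funext fun z => hG.symm_apply z i j
    rw [this, hG.pd_symm i j k, hG.pd_symm j i k]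
    ring
  ext i j
  have h4 := congrFun (congrFun (hG.mul_covDeriv_add_transpose hX hy) i) j
  rw [Matrix.add_apply, Matrix.transpose_apply, Matrix.zero_apply] at h4
  rw [curl, Matrix.of_apply, h1, h1, Matrix.smul_apply, smul_eq_mul]
  simp only [h3 i j]
  linarith

theorem curlUp_eq (hX : IsKillingOn U G X) (hy : y ∈ U) :
    curlUp G X y = (-2 : ℝ) • (covDeriv G X y * (G y)⁻¹) := by
  rw [curlUp, hG.curl_eq hX hy, Matrix.mul_smul, Matrix.smul_mul, ← Matrix.mul_assoc,
    hG.inv_mul hy, Matrix.one_mul]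

theorem trace_covDeriv (hX : IsKillingOn U G X) (hy : y ∈ U) : (covDeriv G X y).trace = 0 := by
  rw [covDeriv, Matrix.trace_add, hG.trace_jacobian hX hy, Matrix.trace_sum]
  simp [Matrix.trace_smul]

omit hG in
theorem curl_transpose (G : EuclideanSpace ℝ (Fin d) → Matrix (Fin d) (Fin d) ℝ)
    (X : Fin d → EuclideanSpace ℝ (Fin d) → ℝ) (z : EuclideanSpace ℝ (Fin d)) :
    (curl G X z).transpose = - curl G X z := by
  ext i j
  simp [curl]

theorem curlUp_transpose (z : EuclideanSpace ℝ (Fin d)) :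
    (curlUp G X z).transpose = - curlUp G X z := by
  rw [curlUp, Matrix.transpose_mul, Matrix.transpose_mul, curl_transpose, hG.inv_symm,
    ← Matrix.mul_assoc, Matrix.mul_neg, Matrix.neg_mul]

theorem curlUp_antisymm (z : EuclideanSpace ℝ (Fin d)) (a b : Fin d) :
    curlUp G X z a b = - curlUp G X z b a :=
  congrFun (congrFun (hG.curlUp_transpose (X := X) z) b) a

/-- In an Einstein metric, the exterior derivative of a Killing covector satisfies Maxwell's
equations with the Killing field itself as current: `∇ₐ Fᵃᵇ = -2 Rᵇ_c Xᶜ = -2 λ Xᵇ`. -/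
theorem div_curlUp (hX : IsKillingOn U G X) {r : ℝ}
    (hric : ∀ i j, ricciCoeff G i j y = r * G y i j) (hy : y ∈ U) (b : Fin d) :
    ∑ a, (pd a (fun z => curlUp G X z a b) y + (connMat G a y).trace * curlUp G X y a b) =
      -2 * r * X b y := by
  have hU := hG.isOpen
  have dB : ∀ a j, DifferentiableAt ℝ (fun z => covDeriv G X z a j) y :=
    fun a j => differentiableAt_of_contDiffOn hU (hG.smooth_covDeriv hX.smooth a j) hy
  have dH : ∀ a j, DifferentiableAt ℝ (fun z => (G z)⁻¹ a j) y :=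
    fun a j => differentiableAt_of_contDiffOn hU (hG.smooth_inv a j) hy
  have hH : ∀ a j, pd a (fun z => (G z)⁻¹ j b) y =
      - (∑ c, christoffel G j a c y * (G y)⁻¹ c b +
        ∑ c, (G y)⁻¹ j c * christoffel G b a c y) := by
    intro a j
    have h := congrFun (congrFun (hG.pdMat_inv_eq hy a) j) b
    simpa only [Matrix.neg_apply, Matrix.add_apply, Matrix.mul_apply, Matrix.transpose_apply,
      connMat, pdMat, Matrix.of_apply] using h
  have h1 : ∀ a, pd a (fun z => curlUp G X z a b) y =
      -2 * ∑ j, (covDeriv G X y a j * pd a (fun z => (G z)⁻¹ j b) y +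
        pd a (fun z => covDeriv G X z a j) y * (G y)⁻¹ j b) := by
    intro a
    have e : ∀ z ∈ U, curlUp G X z a b = -2 * ∑ j, covDeriv G X z a j * (G z)⁻¹ j b := by
      intro z hz
      rw [hG.curlUp_eq hX hz]
      rfl
    rw [pd_congr hU hy e, pd_const_mul (F := fun z => ∑ j, covDeriv G X z a j * (G z)⁻¹ j b)
      (DifferentiableAt.fun_sum fun j _ => (dB a j).fun_mul (dH j b)),
      pd_sum fun j _ => (dB a j).fun_mul (dH j b)]
    congr 1
    exact Finset.sum_congr rfl fun j _ => pd_mul (dB a j) (dH j b) a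
  have h2 : ∀ a, curlUp G X y a b = -2 * ∑ j, covDeriv G X y a j * (G y)⁻¹ j b := by
    intro a
    rw [hG.curlUp_eq hX hy]
    rfl
  -- The Christoffel symbols are symmetric and `curlUp G X` is antisymmetric.
  have h3 : ∑ a, ∑ c, curlUp G X y a c * christoffel G b a c y = 0 := by
    have : ∑ a, ∑ c, curlUp G X y a c * christoffel G b a c y =
        - ∑ a, ∑ c, curlUp G X y a c * christoffel G b a c y := by
      conv_lhs => rw [Finset.sum_comm]
      simp only [← Finset.sum_neg_distrib]
      refine Finset.sum_congr rfl fun a _ => Finset.sum_congr rfl fun c _ => ?_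
      rw [hG.curlUp_antisymm, hG.christoffel_symm]
      ring
    linarith
  have h4 : ∑ a, ∑ j, covDeriv G X y a j * ∑ c, (G y)⁻¹ j c * christoffel G b a c y = 0 := by
    have : ∀ a, ∑ c, curlUp G X y a c * christoffel G b a c y =
        -2 * ∑ j, covDeriv G X y a j * ∑ c, (G y)⁻¹ j c * christoffel G b a c y := by
      intro a
      have e : ∀ c, curlUp G X y a c = -2 * ∑ j, covDeriv G X y a j * (G y)⁻¹ j c := by
        intro c
        rw [hG.curlUp_eq hX hy]
        rfl
      simp only [e, Finset.mul_sum, Finset.sum_mul]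
      rw [Finset.sum_comm]
      exact Finset.sum_congr rfl fun _ _ => Finset.sum_congr rfl fun _ _ => by ring
    simp only [this, ← Finset.mul_sum] at h3
    linarith
  have h5 := hG.div_covDeriv hX.smooth (fun z hz => hG.trace_covDeriv hX hz) hy
  have h6 : ∑ j, (∑ l, ricciCoeff G l j y * X l y) * (G y)⁻¹ j b = r * X b y := by
    have e : (fun j => ∑ l, ricciCoeff G l j y * X l y) =
        r • (G y).mulVec (fun l => X l y) := by
      ext j
      simp only [hric, Pi.smul_apply, smul_eq_mul, Matrix.mulVec, dotProduct, Finset.mul_sum]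
      exact Finset.sum_congr rfl fun l _ => by rw [hG.symm_apply y l j]; ring
    have e2 : ∑ j, (∑ l, ricciCoeff G l j y * X l y) * (G y)⁻¹ j b =
        Matrix.vecMul (fun j => ∑ l, ricciCoeff G l j y * X l y) (G y)⁻¹ b := rfl
    rw [e2, e, ← Matrix.mulVec_transpose, hG.inv_symm, Matrix.mulVec_smul, Matrix.mulVec_mulVec,
      hG.inv_mul hy, Matrix.one_mulVec]
    rfl
  have h7 : ∑ a, ∑ j, covDeriv G X y a j * ∑ c, christoffel G j a c y * (G y)⁻¹ c b =
      ∑ j, (∑ a, ∑ c, covDeriv G X y a c * christoffel G c a j y) * (G y)⁻¹ j b := by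
    simp only [Finset.sum_mul, Finset.mul_sum]
    calc _ = ∑ a, ∑ c, ∑ j, covDeriv G X y a j * (christoffel G j a c y * (G y)⁻¹ c b) :=
          Finset.sum_congr rfl fun a _ => Finset.sum_comm
      _ = ∑ c, ∑ a, ∑ j, covDeriv G X y a j * (christoffel G j a c y * (G y)⁻¹ c b) :=
          Finset.sum_comm
      _ = _ := Finset.sum_congr rfl fun _ _ => Finset.sum_congr rfl fun _ _ =>
          Finset.sum_congr rfl fun _ _ => (mul_assoc _ _ _).symm
  have h8 : ∑ a, ∑ j, covDeriv G X y a j * pd a (fun z => (G z)⁻¹ j b) y =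
      - ∑ j, (∑ a, ∑ c, covDeriv G X y a c * christoffel G c a j y) * (G y)⁻¹ j b := by
    simp only [hH, mul_neg, mul_add, Finset.sum_neg_distrib, Finset.sum_add_distrib, h4, add_zero,
      h7]
  have h9 : ∑ j, (∑ l, ricciCoeff G l j y * X l y) * (G y)⁻¹ j b =
      ∑ a, ∑ j, pd a (fun z => covDeriv G X z a j) y * (G y)⁻¹ j b +
      ∑ a, (connMat G a y).trace * ∑ j, covDeriv G X y a j * (G y)⁻¹ j b -
      ∑ j, (∑ a, ∑ c, covDeriv G X y a c * christoffel G c a j y) * (G y)⁻¹ j b := by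
    simp only [← h5, sub_mul, Finset.sum_sub_distrib, Finset.sum_mul, add_mul,
      Finset.sum_add_distrib, Finset.mul_sum]
    congr 2
    · exact Finset.sum_comm
    · rw [Finset.sum_comm]
      exact Finset.sum_congr rfl fun _ _ => Finset.sum_congr rfl fun _ _ => mul_assoc _ _ _
  have h10 : ∑ a, (pd a (fun z => curlUp G X z a b) y + (connMat G a y).trace * curlUp G X y a b) =
      -2 * (∑ a, ∑ j, covDeriv G X y a j * pd a (fun z => (G z)⁻¹ j b) y +
        ∑ a, ∑ j, pd a (fun z => covDeriv G X z a j) y * (G y)⁻¹ j b +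
        ∑ a, (connMat G a y).trace * ∑ j, covDeriv G X y a j * (G y)⁻¹ j b) := by
    simp only [← Finset.sum_add_distrib]
    rw [Finset.mul_sum]
    refine Finset.sum_congr rfl fun a _ => ?_
    rw [h1, h2]
    ring
  rw [h10, mul_assoc, ← h6, h9, h8]
  ring

end IsMetricOn
end Coordinates

/-! ### The twist in local coordinates -/

section Coordinates

variable {d : ℕ} {U : Set (EuclideanSpace ℝ (Fin d))} {y : EuclideanSpace ℝ (Fin d)}

theorem fderiv_eq_sum_pd (F : EuclideanSpace ℝ (Fin d) → ℝ) (y v : EuclideanSpace ℝ (Fin d)) :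
    fderiv ℝ F y v = ∑ e, v e * pd e F y := by
  have hv : v = ∑ e, v e • (basisVec e : EuclideanSpace ℝ (Fin d)) := by
    ext j
    simp [Pi.single_apply]
  conv_lhs => rw [hv]
  simp only [map_sum, map_smul, smul_eq_mul, pd]

/-- A function whose logarithmic derivative is locally bounded vanishes near each of its zeros. -/
theorem eventually_eq_zero_of_pd_eq {f : EuclideanSpace ℝ (Fin d) → ℝ}
    {c : Fin d → EuclideanSpace ℝ (Fin d) → ℝ} (hU : IsOpen U)
    (hf : ∀ z ∈ U, DifferentiableAt ℝ f z) (hc : ∀ e, ContinuousOn (c e) U)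
    (hpd : ∀ z ∈ U, ∀ e, pd e f z = c e z * f z) (hy : y ∈ U) (h0 : f y = 0) :
    ∀ᶠ z in nhds y, f z = 0 := by
  have h1 : ContinuousAt (fun z => ∑ e, |c e z|) y :=
    tendsto_finsetSum _ fun e _ => ((hc e).continuousAt (hU.mem_nhds hy)).abs
  have h2 : ∀ᶠ z in nhds y, ∑ e, |c e z| < ∑ e, |c e y| + 1 :=
    h1.eventually (gt_mem_nhds (lt_add_one _))
  obtain ⟨r, hr, hball⟩ := Metric.eventually_nhds_iff_ball.1 (h2.and (hU.mem_nhds hy))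
  refine Metric.eventually_nhds_iff_ball.2 ⟨r, hr, fun z hz => ?_⟩
  set C := ∑ e, |c e y| + 1
  set v := z - y with hv
  have hseg : ∀ t ∈ Set.Icc (0 : ℝ) 1, y + t • v ∈ Metric.ball y r := by
    intro t ht
    rw [mem_ball_iff_norm, add_sub_cancel_left, norm_smul, Real.norm_eq_abs, abs_of_nonneg ht.1]
    have hvr : ‖v‖ < r := mem_ball_iff_norm.1 hz
    nlinarith [norm_nonneg v, ht.2]
  have hder : ∀ t ∈ Set.Icc (0 : ℝ) 1, HasDerivAt (fun s : ℝ => f (y + s • v))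
      (fderiv ℝ f (y + t • v) v) t := by
    intro t ht
    have hfd := (hf _ (hball _ (hseg t ht)).2).hasFDerivAt
    have hl : HasDerivAt (fun s : ℝ => y + s • v) v t := by
      simpa using ((hasDerivAt_id t).smul_const v).const_add y
    exact hfd.comp_hasDerivAt t hl
  have hg := eq_zero_of_abs_deriv_le_mul_abs_self_of_eq_zero_right
    (f := fun s : ℝ => f (y + s • v)) (f' := fun t => fderiv ℝ f (y + t • v) v)
    (K := ‖v‖ * C) (a := 0) (b := 1)
    (fun t ht => (hder t ht).continuousAt.continuousWithinAt)
    (fun t ht => (hder t (Set.Ico_subset_Icc_self ht)).hasDerivWithinAt)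
    (by simpa using h0) ?_ 1 (by simp)
  · simpa [hv] using hg
  · intro t ht
    have hb := hball _ (hseg t (Set.Ico_subset_Icc_self ht))
    rw [fderiv_eq_sum_pd]
    calc ‖∑ e, v e * pd e f (y + t • v)‖ ≤ ∑ e, ‖v e * pd e f (y + t • v)‖ := norm_sum_le _ _
      _ ≤ ∑ e, ‖v‖ * |c e (y + t • v)| * ‖f (y + t • v)‖ := by
        refine Finset.sum_le_sum fun e _ => ?_
        rw [hpd _ hb.2, norm_mul, norm_mul, ← mul_assoc]
        gcongr
        · exact PiLp.norm_apply_le v e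
        · exact le_rfl
      _ = ‖v‖ * (∑ e, |c e (y + t • v)|) * ‖f (y + t • v)‖ := by
        rw [Finset.mul_sum, Finset.sum_mul]
      _ ≤ ‖v‖ * C * ‖f (y + t • v)‖ := by
        gcongr
        exact hb.1.le

end Coordinates

section Twist

variable {m : ℕ} {U : Set (EuclideanSpace ℝ (Fin (m + 2)))} {y : EuclideanSpace ℝ (Fin (m + 2))}
  {G : EuclideanSpace ℝ (Fin (m + 2)) → Matrix (Fin (m + 2)) (Fin (m + 2)) ℝ}
  {X : Fin (m + 2) → EuclideanSpace ℝ (Fin (m + 2)) → ℝ}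
  {K : Fin m → Fin (m + 2) → EuclideanSpace ℝ (Fin (m + 2)) → ℝ}

/-- The determinant of a frame as a continuous multilinear map. -/
def detMultilinear (m : ℕ) :
    ContinuousMultilinearMap ℝ (fun _ : Fin (m + 2) => Fin (m + 2) → ℝ) ℝ where
  toMultilinearMap := (Matrix.detRowAlternating (R := ℝ) (n := Fin (m + 2))).toMultilinearMap
  cont := Continuous.matrix_det continuous_id

theorem hasFDerivAt_frameDet (a b : Fin (m + 2) → ℝ)
    (hK : ∀ i j, DifferentiableAt ℝ (K i j) y) :
    HasFDerivAt (fun z => frameDet a b fun i j => K i j z)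
      (∑ i : Fin m, ((detMultilinear m).toContinuousLinearMap
        (Fin.cons a (Fin.cons b (fun i j => K i j y) : Fin (m + 1) → _)) i.succ.succ).comp
          (ContinuousLinearMap.pi fun j => fderiv ℝ (K i j) y)) y := by
  set g : Fin (m + 2) → EuclideanSpace ℝ (Fin (m + 2)) → Fin (m + 2) → ℝ :=
    Fin.cons (fun _ => a)
      (Fin.cons (fun _ => b) (fun i z j => K i j z) : Fin (m + 1) → _) with hgdef
  set g' : Fin (m + 2) → EuclideanSpace ℝ (Fin (m + 2)) →L[ℝ] (Fin (m + 2) → ℝ) :=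
    Fin.cons 0 (Fin.cons 0 (fun i => ContinuousLinearMap.pi fun j => fderiv ℝ (K i j) y) :
      Fin (m + 1) → _) with hgdef'
  have hg : ∀ l, HasFDerivAt (g l) (g' l) y := by
    intro l
    refine Fin.cases ?_ (fun l => Fin.cases ?_ (fun l => ?_) l) l
    · exact hasFDerivAt_const a y
    · exact hasFDerivAt_const b y
    · exact hasFDerivAt_pi.2 fun j => (hK l j).hasFDerivAt
  have hgz : ∀ z, (fun l => g l z) =
      (Fin.cons a (Fin.cons b (fun i j => K i j z) : Fin (m + 1) → _)) := by
    intro z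
    ext l j
    refine Fin.cases ?_ (fun l => Fin.cases ?_ (fun l => ?_) l) l <;> rfl
  have h := HasFDerivAt.multilinear_comp (detMultilinear m) hg
  simp only [hgz] at h
  rw [Fin.sum_univ_succ, Fin.sum_univ_succ] at h
  simp only [hgdef', Fin.cons_zero, Fin.cons_succ, ContinuousLinearMap.comp_zero, zero_add] at h
  exact h

theorem pd_frameDet (a b : Fin (m + 2) → ℝ) (hK : ∀ i j, DifferentiableAt ℝ (K i j) y)
    (e : Fin (m + 2)) :
    pd e (fun z => frameDet a b fun i j => K i j z) y =
      ∑ i, frameDet a b (Function.update (fun i j => K i j y) i fun j => pd e (K i j) y) := by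
  rw [pd, (hasFDerivAt_frameDet a b hK).fderiv, sum_apply]
  refine Finset.sum_congr rfl fun i _ => ?_
  rw [frameDet_eq_det, ← updateRow_cons_succ]
  rfl

/-- The twist scalar of `X` with respect to the fields `K i`, up to the density
`√|det g|`: the contraction of the raised exterior derivative of `X` with the `K i`. -/
def twistFun (G : EuclideanSpace ℝ (Fin (m + 2)) → Matrix (Fin (m + 2)) (Fin (m + 2)) ℝ)
    (X : Fin (m + 2) → EuclideanSpace ℝ (Fin (m + 2)) → ℝ)
    (K : Fin m → Fin (m + 2) → EuclideanSpace ℝ (Fin (m + 2)) → ℝ)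
    (z : EuclideanSpace ℝ (Fin (m + 2))) : ℝ :=
  twist (fun a b => curlUp G X z a b) fun i j => K i j z

theorem differentiableAt_twistFun (hG : IsMetricOn U G) (hX : ∀ j, ContDiffOn ℝ ∞ (X j) U)
    (hK : ∀ i j, ContDiffOn ℝ ∞ (K i j) U) (hy : y ∈ U) :
    DifferentiableAt ℝ (twistFun G X K) y := by
  have dK : ∀ i j, DifferentiableAt ℝ (K i j) y :=
    fun i j => differentiableAt_of_contDiffOn hG.isOpen (hK i j) hy
  change DifferentiableAt ℝ (fun z => ∑ a, ∑ b, curlUp G X z a b *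
    frameDet (Pi.single a 1) (Pi.single b 1) fun i j => K i j z) y
  refine DifferentiableAt.fun_sum fun a _ => DifferentiableAt.fun_sum fun b _ => ?_
  exact (differentiableAt_of_contDiffOn hG.isOpen (hG.smooth_curlUp hX a b) hy).fun_mul
    (hasFDerivAt_frameDet _ _ dK).differentiableAt

theorem pd_twistFun (hG : IsMetricOn U G) (hX : ∀ j, ContDiffOn ℝ ∞ (X j) U)
    (hK : ∀ i j, ContDiffOn ℝ ∞ (K i j) U) (hy : y ∈ U) (e : Fin (m + 2)) :
    pd e (twistFun G X K) y = twist (fun a b => pdMat e (curlUp G X) y a b) (fun i j => K i j y) +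
      ∑ i, twist (fun a b => curlUp G X y a b)
        (Function.update (fun i j => K i j y) i fun j => pd e (K i j) y) := by
  have dK : ∀ i j, DifferentiableAt ℝ (K i j) y :=
    fun i j => differentiableAt_of_contDiffOn hG.isOpen (hK i j) hy
  have d1 : ∀ a b, DifferentiableAt ℝ (fun z => curlUp G X z a b) y := fun a b =>
    differentiableAt_of_contDiffOn hG.isOpen (hG.smooth_curlUp hX a b) hy
  have d2 : ∀ a b, DifferentiableAt ℝ (fun z => frameDet (Pi.single a 1) (Pi.single b 1)
      fun i j => K i j z) y := fun a b => (hasFDerivAt_frameDet _ _ dK).differentiableAt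
  have h1 : pd e (twistFun G X K) y = ∑ a, ∑ b, (curlUp G X y a b *
      ∑ i, frameDet (Pi.single a 1) (Pi.single b 1)
        (Function.update (fun i j => K i j y) i fun j => pd e (K i j) y) +
      pd e (fun z => curlUp G X z a b) y *
        frameDet (Pi.single a 1) (Pi.single b 1) fun i j => K i j y) := by
    change pd e (fun z => ∑ a, ∑ b, curlUp G X z a b *
      frameDet (Pi.single a 1) (Pi.single b 1) fun i j => K i j z) y = _
    rw [pd_sum fun a _ => DifferentiableAt.fun_sum fun b _ => (d1 a b).fun_mul (d2 a b)]
    refine Finset.sum_congr rfl fun a _ => ?_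
    rw [pd_sum fun b _ => (d1 a b).fun_mul (d2 a b)]
    refine Finset.sum_congr rfl fun b _ => ?_
    rw [pd_mul (d1 a b) (d2 a b), pd_frameDet _ _ dK]
  have h2 : ∑ i, twist (fun a b => curlUp G X y a b)
        (Function.update (fun i j => K i j y) i fun j => pd e (K i j) y) =
      ∑ a, ∑ b, curlUp G X y a b * ∑ i, frameDet (Pi.single a 1) (Pi.single b 1)
        (Function.update (fun i j => K i j y) i fun j => pd e (K i j) y) := by
    simp only [twist, Finset.mul_sum]
    rw [Finset.sum_comm]
    exact Finset.sum_congr rfl fun _ _ => Finset.sum_comm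
  rw [h1, h2]
  simp only [Finset.sum_add_distrib]
  exact add_comm _ _

/-- In an Einstein metric, the twist scalars of commuting Killing fields are constant, up to the
density `√|det g|`, whose logarithmic derivative is the trace of the connection. -/
theorem pd_twistFun_eq (hG : IsMetricOn U G) (hK : ∀ i, IsKillingOn U G (K i))
    (hcomm : ∀ i j, ∀ z ∈ U, (jacobian (K i) z).mulVec (fun k => K j k z) =
      (jacobian (K j) z).mulVec (fun k => K i k z)) {r : ℝ}
    (hric : ∀ z ∈ U, ∀ i j, ricciCoeff G i j z = r * G z i j) (μ : Fin m) (hy : y ∈ U)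
    (e : Fin (m + 2)) :
    pd e (twistFun G (K μ) K) y = - (connMat G e y).trace * twistFun G (K μ) K y := by
  set F : Fin (m + 2) → Fin (m + 2) → ℝ := fun a b => curlUp G (K μ) y a b with hF
  set Φ : Fin (m + 2) → Fin (m + 2) → Fin (m + 2) → ℝ := fun c a b =>
    pdMat c (curlUp G (K μ)) y a b + (connMat G c y).trace * F a b with hΦ
  have hdF : ∀ c a b, pdMat c (curlUp G (K μ)) y a b = - pdMat c (curlUp G (K μ)) y b a := by
    intro c a b
    have : (fun z => curlUp G (K μ) z a b) = fun z => -1 * curlUp G (K μ) z b a :=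
      funext fun z => by rw [hG.curlUp_antisymm]; ring
    simp only [pdMat, Matrix.of_apply]
    rw [this, pd_const_mul (differentiableAt_of_contDiffOn hG.isOpen
      (hG.smooth_curlUp (hK μ).smooth b a) hy)]
    ring
  have key := twist_derivative_eq_zero Φ F (fun i j => K i j y) (fun i => jacobian (K i) y) μ
    (-2 * r) ?_ ?_ (fun i j => hcomm i j y hy) ?_ (Pi.single e 1)
  · have h1 : twist (fun a b => ∑ c, (Pi.single e 1 : Fin (m + 2) → ℝ) c * Φ c a b)
        (fun i j => K i j y) =
          twist (fun a b => pdMat e (curlUp G (K μ)) y a b) (fun i j => K i j y) +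
          (connMat G e y).trace * twistFun G (K μ) K y := by
      rw [twistFun, ← twist_smul, ← twist_add]
      congr 1
      ext a b
      simp [Pi.single_apply, hΦ, hF]
    have h2 : ∀ i, (jacobian (K i) y).mulVec (Pi.single e 1) = fun j => pd e (K i j) y := by
      intro i
      ext j
      simp [jacobian]
    rw [h1] at key
    simp only [h2] at key
    rw [pd_twistFun hG (hK μ).smooth (fun i => (hK i).smooth) hy]
    linarith
  · intro c a b
    simp only [hΦ]
    rw [hdF, show F a b = -F b a from hG.curlUp_antisymm y a b]
    ring
  · intro i a b
    have h := congrFun (congrFun (hG.sum_smul_pdMat_curlUp (hK μ).smooth (hK i)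
      (hcomm μ i) hy) a) b
    simp only [Matrix.sum_apply, Matrix.smul_apply, smul_eq_mul, Matrix.add_apply,
      Matrix.mul_apply, Matrix.transpose_apply] at h
    have h' : ∑ c, F a c * jacobian (K i) y b c = ∑ c, jacobian (K i) y b c * F a c :=
      Finset.sum_congr rfl fun _ _ => mul_comm _ _
    rw [h'] at h
    rw [hG.trace_jacobian (hK i) hy, ← h]
    simp only [hΦ, mul_add, Finset.sum_add_distrib, neg_mul, sub_neg_eq_add, Finset.sum_mul,
      mul_assoc]
  · intro b
    exact hG.div_curlUp (hK μ) (hric y hy) hy b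

/-- The zero set of a twist scalar of commuting Killing fields of an Einstein metric is open. -/
theorem eventually_twistFun_eq_zero (hG : IsMetricOn U G) (hK : ∀ i, IsKillingOn U G (K i))
    (hcomm : ∀ i j, ∀ z ∈ U, (jacobian (K i) z).mulVec (fun k => K j k z) =
      (jacobian (K j) z).mulVec (fun k => K i k z)) {r : ℝ}
    (hric : ∀ z ∈ U, ∀ i j, ricciCoeff G i j z = r * G z i j) (μ : Fin m) (hy : y ∈ U)
    (h0 : twistFun G (K μ) K y = 0) : ∀ᶠ z in nhds y, twistFun G (K μ) K z = 0 := by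
  refine eventually_eq_zero_of_pd_eq (c := fun e z => - (connMat G e z).trace) hG.isOpen
    (fun z hz => differentiableAt_twistFun hG (hK μ).smooth (fun i => (hK i).smooth) hz)
    (fun e => ?_) (fun z hz e => pd_twistFun_eq hG hK hcomm hric μ hz e) hy h0
  exact (continuousOn_finsetSum _ fun a _ =>
    (hG.contDiffOn_christoffel a e a).continuousOn).neg

end Twist

/-! ### Raising and lowering indices in the twist -/

section Lowering

variable {m : ℕ}

theorem frameDet_mulVec (N : Matrix (Fin (m + 2)) (Fin (m + 2)) ℝ) (a b : Fin (m + 2) → ℝ)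
    (K : Fin m → Fin (m + 2) → ℝ) :
    frameDet (N.mulVec a) (N.mulVec b) (fun i => N.mulVec (K i)) = N.det * frameDet a b K := by
  rw [frameDet_eq_det, frameDet_eq_det, mul_comm, ← Matrix.det_transpose N, ← Matrix.det_mul]
  congr 1
  ext l j
  rw [Matrix.mul_apply]
  refine Fin.cases ?_ (fun l => Fin.cases ?_ (fun l => ?_) l) l <;>
  · simp only [Matrix.of_apply, Fin.cons_zero, Fin.cons_succ, Matrix.mulVec, dotProduct,
      Matrix.transpose_apply]
    exact Finset.sum_congr rfl fun _ _ => mul_comm _ _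

/-- Lowering all indices multiplies the twist by the determinant of the metric. -/
theorem twist_conj (N F : Matrix (Fin (m + 2)) (Fin (m + 2)) ℝ) (K : Fin m → Fin (m + 2) → ℝ) :
    twist (fun i j => (N * F * N.transpose) i j) (fun i => N.mulVec (K i)) =
      N.det * twist (fun i j => F i j) K := by
  have h1 : ∀ a, N.mulVec (Pi.single a 1) = fun i => N i a := fun a => by ext; simp
  have h2 : ∀ a b, N.det * (F a b * frameDet (Pi.single a 1) (Pi.single b 1) K) =
      ∑ i, ∑ j, N i a * F a b * N j b *
        frameDet (Pi.single i 1) (Pi.single j 1) fun i => N.mulVec (K i) := by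
    intro a b
    rw [mul_left_comm, ← frameDet_mulVec, frameDet_sum_left, Finset.mul_sum]
    refine Finset.sum_congr rfl fun i _ => ?_
    rw [frameDet_sum_right, Finset.mul_sum, Finset.mul_sum]
    refine Finset.sum_congr rfl fun j _ => ?_
    rw [h1, h1]
    ring
  simp only [twist, Finset.mul_sum, h2]
  calc _ = ∑ i, ∑ j, ∑ b, ∑ a, N i a * F a b * N j b *
        frameDet (Pi.single i 1) (Pi.single j 1) fun i => N.mulVec (K i) := by
        simp only [Matrix.mul_apply, Matrix.transpose_apply, Finset.sum_mul]
    _ = ∑ i, ∑ b, ∑ j, ∑ a, N i a * F a b * N j b *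
        frameDet (Pi.single i 1) (Pi.single j 1) fun i => N.mulVec (K i) :=
        Finset.sum_congr rfl fun _ _ => Finset.sum_comm
    _ = ∑ b, ∑ i, ∑ j, ∑ a, N i a * F a b * N j b *
        frameDet (Pi.single i 1) (Pi.single j 1) fun i => N.mulVec (K i) := Finset.sum_comm
    _ = ∑ b, ∑ i, ∑ a, ∑ j, N i a * F a b * N j b *
        frameDet (Pi.single i 1) (Pi.single j 1) fun i => N.mulVec (K i) :=
        Finset.sum_congr rfl fun _ _ => Finset.sum_congr rfl fun _ _ => Finset.sum_comm
    _ = ∑ b, ∑ a, ∑ i, ∑ j, N i a * F a b * N j b *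
        frameDet (Pi.single i 1) (Pi.single j 1) fun i => N.mulVec (K i) :=
        Finset.sum_congr rfl fun _ _ => Finset.sum_comm
    _ = _ := Finset.sum_comm

theorem twist_transpose (F : Fin (m + 2) → Fin (m + 2) → ℝ) (K : Fin m → Fin (m + 2) → ℝ) :
    twist (fun a b => F b a) K = - twist F K := by
  simp only [twist]
  rw [Finset.sum_comm]
  simp only [← Finset.sum_neg_distrib]
  refine Finset.sum_congr rfl fun a _ => Finset.sum_congr rfl fun b _ => ?_
  rw [frameDet_swap, mul_neg]

/-- The twist computed with lower indices, where the partial derivatives of the covector need not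
be antisymmetrized, vanishes if and only if the one with upper indices does. -/
theorem twist_lower_eq_zero_iff {U : Set (EuclideanSpace ℝ (Fin (m + 2)))}
    {y : EuclideanSpace ℝ (Fin (m + 2))}
    {G : EuclideanSpace ℝ (Fin (m + 2)) → Matrix (Fin (m + 2)) (Fin (m + 2)) ℝ}
    (hG : IsMetricOn U G) (hy : y ∈ U) (X : Fin (m + 2) → EuclideanSpace ℝ (Fin (m + 2)) → ℝ)
    (K : Fin m → Fin (m + 2) → EuclideanSpace ℝ (Fin (m + 2)) → ℝ) :
    twist (fun i j => pd i (lower G X j) y) (fun i j => lower G (K i) j y) = 0 ↔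
      twistFun G X K y = 0 := by
  have h1 : twist (fun i j => curl G X y i j) (fun i j => lower G (K i) j y) =
      2 * twist (fun i j => pd i (lower G X j) y) (fun i j => lower G (K i) j y) := by
    have h := twist_add (fun i j => pd i (lower G X j) y)
      (fun i j => -1 * pd j (lower G X i) y) (fun i j => lower G (K i) j y)
    rw [twist_smul, twist_transpose (fun i j => pd i (lower G X j) y)] at h
    rw [two_mul]
    simp only [neg_mul, one_mul, neg_neg, ← sub_eq_add_neg] at h
    exact h
  have h2 : curl G X y = G y * curlUp G X y * (G y).transpose := by
    rw [hG.symm, curlUp, ← Matrix.mul_assoc, ← Matrix.mul_assoc, hG.mul_inv hy, Matrix.one_mul,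
      Matrix.mul_assoc, hG.inv_mul hy, Matrix.mul_one]
  have h3 : twist (fun i j => curl G X y i j) (fun i j => lower G (K i) j y) =
      (G y).det * twistFun G X K y := by
    rw [h2]
    exact twist_conj (G y) (curlUp G X y) fun i j => K i j y
  have h4 := hG.det_ne_zero y hy
  constructor
  · intro h
    rw [h1, h, mul_zero] at h3
    exact (mul_eq_zero.1 h3.symm).resolve_left h4
  · intro h
    rw [h1, h, mul_zero] at h3
    linarith

/-- Let `c` give the coordinates in a basis `D` of `V`, and let `α = ∑ wᵢⱼ Dᵢ ∧ Dⱼ`. As the top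
exterior power of `V` is spanned by the nonzero wedge product of the `Dᵢ`, the element
`α ∧ K₀ ∧ … ∧ Kₘ₋₁` vanishes if and only if its coefficient does. -/
theorem sum_smul_ι_mul_ιMulti_eq_zero_iff {V : Type*} [AddCommGroup V] [Module ℝ V]
    (c : V ≃ₗ[ℝ] (Fin (m + 2) → ℝ)) (D : Fin (m + 2) → V) (hD : ∀ i, c (D i) = Pi.single i 1)
    (w : Fin (m + 2) → Fin (m + 2) → ℝ) (K : Fin m → V) :
    (∑ i, ∑ j, w i j • (ExteriorAlgebra.ι ℝ (D i) * ExteriorAlgebra.ι ℝ (D j))) *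
      ExteriorAlgebra.ιMulti ℝ m K = 0 ↔ twist w (fun i => c (K i)) = 0 := by
  set Δ : V [⋀^Fin (m + 2)]→ₗ[ℝ] ℝ :=
    (Matrix.detRowAlternating (R := ℝ) (n := Fin (m + 2))).compLinearMap c.toLinearMap with hΔ
  have hΔD : Δ D = 1 := by
    have : (fun i => c (D i)) = (1 : Matrix (Fin (m + 2)) (Fin (m + 2)) ℝ) := by
      ext i j
      rw [hD, Matrix.one_apply, Pi.single_apply]
      simp [eq_comm]
    change Matrix.det (fun i => c (D i)) = 1
    rw [this, Matrix.det_one]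
  have htop : ∀ v, ExteriorAlgebra.ιMulti ℝ (m + 2) v =
      Δ v • ExteriorAlgebra.ιMulti ℝ (m + 2) D := by
    set e := Module.Basis.ofEquivFun c with he
    have heD : ⇑e = D := by
      ext i
      apply c.injective
      rw [hD, he, Module.Basis.coe_ofEquivFun, LinearEquiv.apply_symm_apply]
    have h : ExteriorAlgebra.ιMulti ℝ (M := V) (m + 2) = (LinearMap.toSpanSingleton ℝ _
        (ExteriorAlgebra.ιMulti ℝ (m + 2) D)).compAlternatingMap Δ := by
      refine Module.Basis.ext_alternating e fun i hi => ?_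
      let σ : Equiv.Perm (Fin (m + 2)) := Equiv.ofBijective i (Finite.injective_iff_bijective.1 hi)
      change ExteriorAlgebra.ιMulti ℝ (m + 2) (e ∘ σ) = Δ (e ∘ σ) • _
      rw [AlternatingMap.map_perm, AlternatingMap.map_perm, heD, hΔD]
      rw [Units.smul_def, Units.smul_def, smul_assoc, one_smul]
    intro v
    exact congrArg (fun f => f v) h
  have h1 : (∑ i, ∑ j, w i j • (ExteriorAlgebra.ι ℝ (D i) * ExteriorAlgebra.ι ℝ (D j))) *
      ExteriorAlgebra.ιMulti ℝ m K =
      twist w (fun i => c (K i)) • ExteriorAlgebra.ιMulti ℝ (m + 2) D := by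
    simp only [twist, Finset.sum_mul, Finset.sum_smul]
    refine Finset.sum_congr rfl fun i _ => Finset.sum_congr rfl fun j _ => ?_
    have h2 : ExteriorAlgebra.ι ℝ (D i) * ExteriorAlgebra.ι ℝ (D j) *
        ExteriorAlgebra.ιMulti ℝ m K = ExteriorAlgebra.ιMulti ℝ (m + 2)
          (Fin.cons (D i) (Fin.cons (D j) K : Fin (m + 1) → V)) := by
      rw [ExteriorAlgebra.ιMulti_succ_apply, ExteriorAlgebra.ιMulti_succ_apply, mul_assoc]
      rfl
    have h3 : Δ (Fin.cons (D i) (Fin.cons (D j) K : Fin (m + 1) → V)) =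
        frameDet (Pi.single i 1) (Pi.single j 1) (fun i => c (K i)) := by
      rw [hΔ, frameDet, AlternatingMap.compLinearMap_apply]
      congr 1
      ext l : 1
      refine Fin.cases ?_ (fun l => Fin.cases ?_ (fun l => ?_) l) l
      · exact hD i
      · exact hD j
      · rfl
    rw [smul_mul_assoc, h2, htop, h3, smul_smul]
  have h4 : ExteriorAlgebra.ιMulti ℝ (m + 2) D ≠ 0 := by
    intro h
    have h5 := ExteriorAlgebra.liftAlternating_apply_ιMulti (R := ℝ)
      (fun k => if hk : k = m + 2 then hk ▸ Δ else 0) D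
    rw [h, map_zero, dif_pos rfl] at h5
    exact zero_ne_one (h5.trans hΔD)
  rw [h1, smul_eq_zero, or_iff_left h4]

end Lowering

/-! ### Charts -/

section Charts

variable {d : ℕ} {M : Type*} [TopologicalSpace M] [ChartedSpace (EuclideanSpace ℝ (Fin d)) M]
  [IsManifold (𝓡 d) ∞ M] {φ : OpenPartialHomeomorph M (EuclideanSpace ℝ (Fin d))}
  {y : EuclideanSpace ℝ (Fin d)}

omit [IsManifold (𝓡 d) ∞ M] in
theorem mdifferentiable_of_mem_maximalAtlas (hφ : φ ∈ IsManifold.maximalAtlas (𝓡 d) ∞ M) :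
    φ.MDifferentiable (𝓡 d) (𝓡 d) :=
  ⟨(contMDiffOn_of_mem_maximalAtlas hφ).mdifferentiableOn (by simp),
    (contMDiffOn_symm_of_mem_maximalAtlas hφ).mdifferentiableOn (by simp)⟩

omit [IsManifold (𝓡 d) ∞ M] in
theorem mfderiv_coordVec (hφ : φ ∈ IsManifold.maximalAtlas (𝓡 d) ∞ M) (hy : y ∈ φ.target)
    (j : Fin d) : mfderiv (𝓡 d) (𝓡 d) φ (φ.symm y) (coordVec φ j y) = basisVec j :=
  DFunLike.congr_fun ((mdifferentiable_of_mem_maximalAtlas hφ).comp_symm_deriv hy) (basisVec j)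

omit [IsManifold (𝓡 d) ∞ M] in
theorem coordCovec_coordVec (hφ : φ ∈ IsManifold.maximalAtlas (𝓡 d) ∞ M) (hy : y ∈ φ.target)
    (i j : Fin d) : coordCovec φ i (φ.symm y) (coordVec φ j y) = if i = j then 1 else 0 := by
  refine (congrArg (EuclideanSpace.proj (𝕜 := ℝ) i : EuclideanSpace ℝ (Fin d) →L[ℝ] ℝ)
    (mfderiv_coordVec hφ hy j)).trans ?_
  simp

omit [IsManifold (𝓡 d) ∞ M] in
theorem sum_coordCovec_smul_coordVec (hφ : φ ∈ IsManifold.maximalAtlas (𝓡 d) ∞ M)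
    (hy : y ∈ φ.target) (v : TangentSpace (𝓡 d) (φ.symm y)) :
    ∑ k, coordCovec φ k (φ.symm y) v • coordVec φ k y = v := by
  apply (mdifferentiable_of_mem_maximalAtlas hφ).mfderiv_injective (φ.map_target hy)
  rw [map_sum]
  simp only [map_smul, mfderiv_coordVec hφ hy]
  refine PiLp.ext (p := 2) (α := fun _ : Fin d => ℝ) fun j => ?_
  change (∑ k, coordCovec φ k (φ.symm y) v • (basisVec k : EuclideanSpace ℝ (Fin d))) j =
    coordCovec φ j (φ.symm y) v
  simp [Pi.single_apply]

theorem contMDiffOn_coordVec (hφ : φ ∈ IsManifold.maximalAtlas (𝓡 d) ∞ M) (i : Fin d) :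
    ContMDiffOn (𝓡 d) (𝓡 d).tangent ∞
      (fun y => (⟨φ.symm y, coordVec φ i y⟩ : TangentBundle (𝓡 d) M)) φ.target := by
  have h1 : ContMDiffOn (𝓡 d) (𝓡 d).tangent ∞ (fun y : EuclideanSpace ℝ (Fin d) =>
      (⟨y, basisVec i⟩ : TangentBundle (𝓡 d) (EuclideanSpace ℝ (Fin d)))) φ.target :=
    contMDiffOn_vectorSpace_iff_contDiffOn.2 contDiffOn_const
  have h2 := (contMDiffOn_symm_of_mem_maximalAtlas hφ).contMDiffOn_tangentMapWithin (m := ∞)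
    (by simp) φ.open_target.uniqueMDiffOn
  refine (h2.comp h1 fun y hy => hy).congr fun y hy => ?_
  simp only [Function.comp_apply, tangentMapWithin, coordVec,
    mfderivWithin_of_isOpen φ.open_target hy]

theorem contDiffOn_metricCoeff (g : PseudoRiemannianMetric d M)
    (hφ : φ ∈ IsManifold.maximalAtlas (𝓡 d) ∞ M) (i j : Fin d) :
    ContDiffOn ℝ ∞ (fun y => metricCoeff g φ y i j) φ.target := by
  rw [← contMDiffOn_iff_contDiffOn]
  intro y hy
  have : ContMDiffWithinAt (𝓡 d) ((𝓡 d).prod 𝓘(ℝ)) ∞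
      (fun y => Bundle.TotalSpace.mk' ℝ (E := Bundle.Trivial M ℝ) (φ.symm y)
        (g.inner (φ.symm y) (coordVec φ i y) (coordVec φ j y))) φ.target y := by
    apply ContMDiffWithinAt.clm_bundle_apply₂ (F₁ := EuclideanSpace ℝ (Fin d))
      (F₂ := EuclideanSpace ℝ (Fin d))
    · exact ContMDiffAt.comp_contMDiffWithinAt y g.contMDiff.contMDiffAt
        (contMDiffOn_symm_of_mem_maximalAtlas hφ y hy)
    · exact contMDiffOn_coordVec hφ i y hy
    · exact contMDiffOn_coordVec hφ j y hy
  simp only [Bundle.contMDiffWithinAt_totalSpace] at this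
  exact this.2

theorem isMetricOn_metricCoeff (g : PseudoRiemannianMetric d M)
    (hφ : φ ∈ IsManifold.maximalAtlas (𝓡 d) ∞ M) : IsMetricOn φ.target (metricCoeff g φ) where
  isOpen := φ.open_target
  smooth := contDiffOn_metricCoeff g hφ
  symm z := by
    ext i j
    exact g.symm _ _ _
  det_ne_zero z hz h := by
    obtain ⟨v, hv, hv0⟩ := Matrix.exists_mulVec_eq_zero_iff.2 h
    apply hv
    have h1 : ∑ k, v k • coordVec φ k z = 0 := by
      apply g.nondegenerate
      intro w
      rw [← sum_coordCovec_smul_coordVec hφ hz w, map_sum]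
      refine Finset.sum_eq_zero fun i _ => ?_
      rw [map_smul, g.symm, map_sum]
      have := congrFun hv0 i
      simp only [Matrix.mulVec, dotProduct, metricCoeff, Matrix.of_apply, Pi.zero_apply] at this
      simp only [map_smul, smul_eq_mul]
      rw [← mul_zero (coordCovec φ i (φ.symm z) w), ← this]
      congr 1
      exact Finset.sum_congr rfl fun k _ => mul_comm _ _
    ext k
    have h2 := congrArg (coordCovec φ k (φ.symm z)) h1
    simpa [coordCovec_coordVec hφ hz] using h2

/-- The vector field `X` in the chart `φ`. -/
def chartField (φ : OpenPartialHomeomorph M (EuclideanSpace ℝ (Fin d)))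
    (X : ∀ p : M, TangentSpace (𝓡 d) p) (y : EuclideanSpace ℝ (Fin d)) :
    EuclideanSpace ℝ (Fin d) :=
  mfderiv (𝓡 d) (𝓡 d) φ (φ.symm y) (X (φ.symm y))

omit [IsManifold (𝓡 d) ∞ M] in
theorem inverse_mfderiv_symm (hφ : φ ∈ IsManifold.maximalAtlas (𝓡 d) ∞ M) (hy : y ∈ φ.target) :
    (mfderiv (𝓡 d) (𝓡 d) φ.symm y).inverse = mfderiv (𝓡 d) (𝓡 d) φ (φ.symm y) := by
  have h := mdifferentiable_of_mem_maximalAtlas hφ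
  refine ContinuousLinearMap.inverse_eq ?_ (h.comp_symm_deriv hy)
  have h2 := h.symm_comp_deriv (φ.map_target hy)
  rwa [φ.right_inv hy] at h2

omit [IsManifold (𝓡 d) ∞ M] in
theorem mpullback_symm (hφ : φ ∈ IsManifold.maximalAtlas (𝓡 d) ∞ M) (hy : y ∈ φ.target)
    (X : ∀ p : M, TangentSpace (𝓡 d) p) :
    VectorField.mpullback (𝓡 d) (𝓡 d) φ.symm X y = chartField φ X y := by
  rw [VectorField.mpullback_apply, inverse_mfderiv_symm hφ hy]
  rfl

theorem contDiffOn_chartField (hφ : φ ∈ IsManifold.maximalAtlas (𝓡 d) ∞ M)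
    {X : ∀ p : M, TangentSpace (𝓡 d) p} (hX : ContMDiff (𝓡 d) (𝓡 d).tangent ∞
      (fun p : M => (⟨p, X p⟩ : TangentBundle (𝓡 d) M))) :
    ContDiffOn ℝ ∞ (chartField φ X) φ.target := by
  refine contMDiffOn_vectorSpace_iff_contDiffOn.1 ?_
  have h1 : ContMDiffOn (𝓡 d) (𝓡 d).tangent ∞
      (fun y => (⟨φ.symm y, X (φ.symm y)⟩ : TangentBundle (𝓡 d) M)) φ.target :=
    hX.comp_contMDiffOn (contMDiffOn_symm_of_mem_maximalAtlas hφ)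
  have h2 := (contMDiffOn_of_mem_maximalAtlas hφ).contMDiffOn_tangentMapWithin (m := ∞)
    (by simp) φ.open_source.uniqueMDiffOn
  refine (h2.comp h1 fun y hy => φ.map_target hy).congr fun y hy => ?_
  simp only [Function.comp_apply, tangentMapWithin, chartField,
    mfderivWithin_of_isOpen φ.open_source (φ.map_target hy)]
  exact Bundle.TotalSpace.ext (φ.right_inv hy).symm HEq.rfl

theorem contDiffOn_vecCoeff (hφ : φ ∈ IsManifold.maximalAtlas (𝓡 d) ∞ M)
    {X : ∀ p : M, TangentSpace (𝓡 d) p} (hX : ContMDiff (𝓡 d) (𝓡 d).tangent ∞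
      (fun p : M => (⟨p, X p⟩ : TangentBundle (𝓡 d) M))) (i : Fin d) :
    ContDiffOn ℝ ∞ (vecCoeff φ X i) φ.target :=
  (EuclideanSpace.proj (𝕜 := ℝ) i : EuclideanSpace ℝ (Fin d) →L[ℝ] ℝ).contDiff.comp_contDiffOn
    (contDiffOn_chartField hφ hX)

theorem isKillingOn_vecCoeff {g : PseudoRiemannianMetric d M}
    (hφ : φ ∈ IsManifold.maximalAtlas (𝓡 d) ∞ M)
    {X : ∀ p : M, TangentSpace (𝓡 d) p} (hX : IsKilling g X) :
    IsKillingOn φ.target (metricCoeff g φ) (vecCoeff φ X) where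
  smooth := contDiffOn_vecCoeff hφ hX.contMDiff
  killing z hz := by
    ext i j
    rw [Matrix.zero_apply, ← hX.lieDeriv_eq_zero φ hφ z hz i j]
    simp only [Matrix.add_apply, Matrix.sum_apply, Matrix.smul_apply, smul_eq_mul, pdMat,
      Matrix.of_apply, Matrix.mul_apply, Matrix.transpose_apply, jacobian,
      Finset.sum_add_distrib]
    congr 2
    exact Finset.sum_congr rfl fun _ _ => mul_comm _ _

theorem jacobian_mulVec (hφ : φ ∈ IsManifold.maximalAtlas (𝓡 d) ∞ M)
    {X Y : ∀ p : M, TangentSpace (𝓡 d) p}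
    (hX : ContMDiff (𝓡 d) (𝓡 d).tangent ∞ (fun p : M => (⟨p, X p⟩ : TangentBundle (𝓡 d) M)))
    (hy : y ∈ φ.target) (k : Fin d) :
    (jacobian (vecCoeff φ X) y).mulVec (fun k => vecCoeff φ Y k y) k =
      (fderiv ℝ (chartField φ X) y (chartField φ Y y)) k := by
  have hd : DifferentiableAt ℝ (chartField φ X) y :=
    ((contDiffOn_chartField hφ hX y hy).contDiffAt
      (φ.open_target.mem_nhds hy)).differentiableAt (by simp)
  have h : fderiv ℝ (vecCoeff φ X k) y =
      (EuclideanSpace.proj (𝕜 := ℝ) k : EuclideanSpace ℝ (Fin d) →L[ℝ] ℝ).comp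
        (fderiv ℝ (chartField φ X) y) :=
    ((EuclideanSpace.proj (𝕜 := ℝ) k : EuclideanSpace ℝ (Fin d) →L[ℝ] ℝ).hasFDerivAt.comp y
      hd.hasFDerivAt).fderiv
  have h2 : (fderiv ℝ (chartField φ X) y (chartField φ Y y)) k =
      fderiv ℝ (vecCoeff φ X k) y (chartField φ Y y) := by
    rw [h]
    rfl
  rw [h2, fderiv_eq_sum_pd]
  change ∑ e, pd e (vecCoeff φ X k) y * vecCoeff φ Y e y =
    ∑ e, vecCoeff φ Y e y * pd e (vecCoeff φ X k) y
  exact Finset.sum_congr rfl fun e _ => mul_comm (pd e (vecCoeff φ X k) y) (vecCoeff φ Y e y)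

/-- Commuting vector fields commute in local coordinates. -/
theorem jacobian_mulVec_comm (hφ : φ ∈ IsManifold.maximalAtlas (𝓡 d) ∞ M)
    {X Y : ∀ p : M, TangentSpace (𝓡 d) p}
    (hX : ContMDiff (𝓡 d) (𝓡 d).tangent ∞ (fun p : M => (⟨p, X p⟩ : TangentBundle (𝓡 d) M)))
    (hY : ContMDiff (𝓡 d) (𝓡 d).tangent ∞ (fun p : M => (⟨p, Y p⟩ : TangentBundle (𝓡 d) M)))
    (hXY : VectorField.mlieBracket (𝓡 d) X Y = 0) (hy : y ∈ φ.target) :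
    (jacobian (vecCoeff φ X) y).mulVec (fun k => vecCoeff φ Y k y) =
      (jacobian (vecCoeff φ Y) y).mulVec (fun k => vecCoeff φ X k y) := by
  have : IsManifold (𝓡 d) (minSmoothness ℝ 2) M := by
    rw [minSmoothness_of_isRCLikeNormedField]
    exact IsManifold.of_le (n := ∞) (WithTop.coe_le_coe.2 le_top)
  have h1 : VectorField.mlieBracket (𝓡 d) (VectorField.mpullback (𝓡 d) (𝓡 d) φ.symm X)
      (VectorField.mpullback (𝓡 d) (𝓡 d) φ.symm Y) y = 0 := by
    rw [← VectorField.mpullback_mlieBracket (n := ∞)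
      (hX.contMDiffAt.mdifferentiableAt (by simp)) (hY.contMDiffAt.mdifferentiableAt (by simp))
      ((contMDiffOn_symm_of_mem_maximalAtlas hφ).contMDiffAt (φ.open_target.mem_nhds hy))
      (by rw [minSmoothness_of_isRCLikeNormedField]; exact WithTop.coe_le_coe.2 le_top),
      VectorField.mpullback_apply, hXY]
    simp
  have hev : ∀ Z : ∀ p : M, TangentSpace (𝓡 d) p,
      VectorField.mpullback (𝓡 d) (𝓡 d) φ.symm Z =ᶠ[nhds y] chartField φ Z := fun Z =>
    Filter.eventuallyEq_of_mem (φ.open_target.mem_nhds hy) fun z hz => mpullback_symm hφ hz Z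
  rw [(hev X).mlieBracket_vectorField_eq (hev Y)] at h1
  have hflat : ∀ V W : ∀ z : EuclideanSpace ℝ (Fin d), TangentSpace (𝓡 d) z,
      VectorField.mlieBracket (𝓡 d) V W = VectorField.lieBracket ℝ V W := fun V W => by
    rw [← VectorField.mlieBracketWithin_univ, VectorField.mlieBracketWithin_eq_lieBracketWithin]
    exact VectorField.lieBracketWithin_univ
  have h2 : VectorField.lieBracket ℝ (chartField φ X) (chartField φ Y) y = 0 :=
    (congrFun (hflat _ _) y).symm.trans h1
  rw [VectorField.lieBracket, sub_eq_zero] at h2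
  ext k
  rw [jacobian_mulVec hφ hX hy, jacobian_mulVec hφ hY hy, h2]

theorem formCoeff_flat (g : PseudoRiemannianMetric d M)
    (hφ : φ ∈ IsManifold.maximalAtlas (𝓡 d) ∞ M) (X : ∀ p : M, TangentSpace (𝓡 d) p) (j : Fin d)
    (hy : y ∈ φ.target) :
    formCoeff φ (flat g X) j y = lower (metricCoeff g φ) (vecCoeff φ X) j y := by
  change g.inner (φ.symm y) (X (φ.symm y)) (coordVec φ j y) = _
  rw [g.symm]
  conv_lhs => rw [← sum_coordCovec_smul_coordVec hφ hy (X (φ.symm y))]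
  rw [map_sum]
  refine Finset.sum_congr rfl fun k _ => ?_
  rw [map_smul, smul_eq_mul, mul_comm]
  rfl

theorem contDiffOn_formCoeff_flat (g : PseudoRiemannianMetric d M)
    (hφ : φ ∈ IsManifold.maximalAtlas (𝓡 d) ∞ M) {X : ∀ p : M, TangentSpace (𝓡 d) p}
    (hX : ContMDiff (𝓡 d) (𝓡 d).tangent ∞ (fun p : M => (⟨p, X p⟩ : TangentBundle (𝓡 d) M)))
    (j : Fin d) : ContDiffOn ℝ ∞ (formCoeff φ (flat g X) j) φ.target :=
  ((isMetricOn_metricCoeff g hφ).contDiffOn_lower (contDiffOn_vecCoeff hφ hX) j).congr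
    fun _ hy => formCoeff_flat g hφ X j hy

end Charts

/-! ### Independence of the chart -/

section ChartIndependence

variable {d : ℕ} {M : Type*} [TopologicalSpace M] [ChartedSpace (EuclideanSpace ℝ (Fin d)) M]
  {φ ψ : OpenPartialHomeomorph M (EuclideanSpace ℝ (Fin d))}
  {y : EuclideanSpace ℝ (Fin d)}

theorem apply_eq_sum_formCoeff (hφ : φ ∈ IsManifold.maximalAtlas (𝓡 d) ∞ M) (hy : y ∈ φ.target)
    (α : ∀ p : M, Module.Dual ℝ (TangentSpace (𝓡 d) p)) :
    α (φ.symm y) = ∑ l, formCoeff φ α l y • coordCovec φ l (φ.symm y) := by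
  ext v
  conv_lhs => rw [← sum_coordCovec_smul_coordVec hφ hy v]
  rw [map_sum, LinearMap.sum_apply]
  refine Finset.sum_congr rfl fun l _ => ?_
  rw [map_smul, smul_eq_mul, LinearMap.smul_apply, smul_eq_mul, mul_comm]
  rfl

/-- The `l`-th component of the transition map from `φ` to `ψ`. -/
def transition (φ ψ : OpenPartialHomeomorph M (EuclideanSpace ℝ (Fin d))) (l : Fin d)
    (y : EuclideanSpace ℝ (Fin d)) : ℝ :=
  ψ (φ.symm y) l

theorem contDiffOn_transition (hφ : φ ∈ IsManifold.maximalAtlas (𝓡 d) ∞ M)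
    (hψ : ψ ∈ IsManifold.maximalAtlas (𝓡 d) ∞ M) :
    ContDiffOn ℝ ∞ (fun y => ψ (φ.symm y)) (φ.target ∩ φ.symm ⁻¹' ψ.source) := by
  rw [← contMDiffOn_iff_contDiffOn]
  exact (contMDiffOn_of_mem_maximalAtlas hψ).comp
    ((contMDiffOn_symm_of_mem_maximalAtlas hφ).mono Set.inter_subset_left)
    Set.inter_subset_right

omit [ChartedSpace (EuclideanSpace ℝ (Fin d)) M] in
theorem isOpen_transition_source :
    IsOpen (φ.target ∩ φ.symm ⁻¹' ψ.source) :=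
  φ.symm.isOpen_inter_preimage ψ.open_source

/-- The entries of the Jacobian matrix of the transition map are the components of the differentials
of one chart in the other. -/
theorem coordCovec_transition (hφ : φ ∈ IsManifold.maximalAtlas (𝓡 d) ∞ M)
    (hψ : ψ ∈ IsManifold.maximalAtlas (𝓡 d) ∞ M) (hy : y ∈ φ.target)
    (hy' : φ.symm y ∈ ψ.source) (l j : Fin d) :
    coordCovec ψ l (φ.symm y) (coordVec φ j y) = pd j (transition φ ψ l) y := by
  have h1 : HasFDerivAt (fun y => ψ (φ.symm y)) (mfderiv (𝓡 d) (𝓡 d) (ψ ∘ φ.symm) y) y := by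
    rw [mfderiv_eq_fderiv]
    exact (((contDiffOn_transition hφ hψ y ⟨hy, hy'⟩).contDiffAt
      (isOpen_transition_source.mem_nhds ⟨hy, hy'⟩)).differentiableAt (by simp)).hasFDerivAt
  have h2 := ((EuclideanSpace.proj (𝕜 := ℝ) l :
    EuclideanSpace ℝ (Fin d) →L[ℝ] ℝ).hasFDerivAt.comp y h1).fderiv
  have h3 : fderiv ℝ (transition φ ψ l) y = (EuclideanSpace.proj (𝕜 := ℝ) l :
    EuclideanSpace ℝ (Fin d) →L[ℝ] ℝ).comp (mfderiv (𝓡 d) (𝓡 d) (ψ ∘ φ.symm) y) := h2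
  rw [pd, h3, mfderiv_comp y ((mdifferentiable_of_mem_maximalAtlas hψ).mdifferentiableAt hy')
    ((mdifferentiable_of_mem_maximalAtlas hφ).mdifferentiableAt_symm hy)]
  rfl

/-- The exterior derivative of a one-form does not depend on the chart used to compute it. -/
theorem extDerivOneForm_eq (hφ : φ ∈ IsManifold.maximalAtlas (𝓡 d) ∞ M)
    (hψ : ψ ∈ IsManifold.maximalAtlas (𝓡 d) ∞ M)
    (α : ∀ p : M, Module.Dual ℝ (TangentSpace (𝓡 d) p))
    (hα : ∀ l, ContDiffOn ℝ ∞ (formCoeff ψ α l) ψ.target) {p : M} (hp : p ∈ φ.source)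
    (hp' : p ∈ ψ.source) : extDerivOneForm φ α p = extDerivOneForm ψ α p := by
  obtain ⟨y, hy, rfl⟩ : ∃ y ∈ φ.target, φ.symm y = p := ⟨φ p, φ.map_source hp, φ.left_inv hp⟩
  set O := φ.target ∩ φ.symm ⁻¹' ψ.source with hO
  have hOo : IsOpen O := isOpen_transition_source
  have hyO : y ∈ O := ⟨hy, hp'⟩
  set T := transition φ ψ with hT
  have hTs : ∀ l, ContDiffOn ℝ ∞ (T l) O := fun l =>
    (EuclideanSpace.proj (𝕜 := ℝ) l : EuclideanSpace ℝ (Fin d) →L[ℝ] ℝ).contDiff.comp_contDiffOn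
      (contDiffOn_transition hφ hψ)
  set b : Fin d → EuclideanSpace ℝ (Fin d) → ℝ := fun l z => formCoeff ψ α l (ψ (φ.symm z)) with hb
  have hbs : ∀ l, ContDiffOn ℝ ∞ (b l) O := fun l =>
    (hα l).comp (contDiffOn_transition hφ hψ) fun z hz => ψ.map_source hz.2
  -- The coefficients of `α` transform by the Jacobian matrix of the transition map.
  have h1 : ∀ j, ∀ z ∈ O, formCoeff φ α j z = ∑ l, b l z * pd j (T l) z := by
    intro j z hz
    obtain ⟨w, hw, hwz⟩ : ∃ w ∈ ψ.target, ψ.symm w = φ.symm z :=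
      ⟨ψ (φ.symm z), ψ.map_source hz.2, ψ.left_inv hz.2⟩
    have h2 := apply_eq_sum_formCoeff hψ hw α
    have h3 : w = ψ (φ.symm z) := by rw [← hwz, ψ.right_inv hw]
    rw [hwz] at h2
    rw [formCoeff, h2, LinearMap.sum_apply]
    refine Finset.sum_congr rfl fun l _ => ?_
    rw [LinearMap.smul_apply, smul_eq_mul, coordCovec_transition hφ hψ hz.1 hz.2, h3]
  have h4 : ∀ l, coordCovec ψ l (φ.symm y) =
      ∑ j, pd j (T l) y • coordCovec φ j (φ.symm y) := by
    intro l
    rw [apply_eq_sum_formCoeff hφ hy (coordCovec ψ l)]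
    refine Finset.sum_congr rfl fun j _ => ?_
    rw [formCoeff, coordCovec_transition hφ hψ hy hp']
  have h5 : ∀ i l, pd i (b l) y = ∑ k, pd k (formCoeff ψ α l) (ψ (φ.symm y)) * pd i (T k) y := by
    intro i l
    have hτ : HasFDerivAt (fun y => ψ (φ.symm y)) (fderiv ℝ (fun y => ψ (φ.symm y)) y) y :=
      (((contDiffOn_transition hφ hψ y hyO).contDiffAt
        (hOo.mem_nhds hyO)).differentiableAt (by simp)).hasFDerivAt
    have hf := (differentiableAt_of_contDiffOn ψ.open_target (hα l)
      (ψ.map_source hp')).hasFDerivAt.comp y hτ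
    have hcomp : ∀ k, (fderiv ℝ (fun y => ψ (φ.symm y)) y (basisVec i)) k = pd i (T k) y := by
      intro k
      have h := ((EuclideanSpace.proj (𝕜 := ℝ) k :
        EuclideanSpace ℝ (Fin d) →L[ℝ] ℝ).hasFDerivAt.comp y hτ).fderiv
      have h' : fderiv ℝ (T k) y = (EuclideanSpace.proj (𝕜 := ℝ) k :
        EuclideanSpace ℝ (Fin d) →L[ℝ] ℝ).comp (fderiv ℝ (fun y => ψ (φ.symm y)) y) := h
      rw [pd, h']
      rfl
    have hfd : fderiv ℝ (b l) y = (fderiv ℝ (formCoeff ψ α l) (ψ (φ.symm y))).comp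
      (fderiv ℝ (fun y => ψ (φ.symm y)) y) := hf.fderiv
    rw [pd, hfd, ContinuousLinearMap.comp_apply, fderiv_eq_sum_pd]
    refine Finset.sum_congr rfl fun k _ => ?_
    rw [hcomp, mul_comm]
  have dT : ∀ l j, DifferentiableAt ℝ (pd j (T l)) y := fun l j =>
    differentiableAt_of_contDiffOn hOo (contDiffOn_pd hOo (hTs l) j) hyO
  have db : ∀ l, DifferentiableAt ℝ (b l) y := fun l =>
    differentiableAt_of_contDiffOn hOo (hbs l) hyO
  have h6 : ∀ i j, pd i (formCoeff φ α j) y =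
      ∑ l, (b l y * pd i (pd j (T l)) y + pd i (b l) y * pd j (T l) y) := by
    intro i j
    rw [pd_congr hOo hyO (h1 j), pd_sum fun l _ => (db l).fun_mul (dT l j)]
    exact Finset.sum_congr rfl fun l _ => pd_mul (db l) (dT l j) i
  set e : Fin d → Fin d → ExteriorAlgebra ℝ (Module.Dual ℝ (TangentSpace (𝓡 d) (φ.symm y))) :=
    fun i j => ExteriorAlgebra.ι ℝ (coordCovec φ i (φ.symm y)) *
      ExteriorAlgebra.ι ℝ (coordCovec φ j (φ.symm y)) with he
  have hanti : ∀ i j, e i j = - e j i := fun i j =>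
    eq_neg_of_add_eq_zero_left (ExteriorAlgebra.ι_add_mul_swap _ _)
  -- The second derivatives of the transition map are symmetric and do not contribute.
  have h7 : ∑ i, ∑ j, (∑ l, b l y * pd i (pd j (T l)) y) • e i j = 0 := by
    have h8 : ∑ i, ∑ j, (∑ l, b l y * pd i (pd j (T l)) y) • e i j =
        - ∑ i, ∑ j, (∑ l, b l y * pd i (pd j (T l)) y) • e i j := by
      conv_lhs => rw [Finset.sum_comm]
      simp only [← Finset.sum_neg_distrib]
      refine Finset.sum_congr rfl fun i _ => Finset.sum_congr rfl fun j _ => ?_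
      rw [hanti j i, smul_neg]
      congr 2
      exact Finset.sum_congr rfl fun l _ => by rw [pd_comm hOo (hTs l) hyO]
    rw [eq_neg_iff_add_eq_zero, ← two_smul ℝ] at h8
    exact (smul_eq_zero.1 h8).resolve_left two_ne_zero
  have h9 : extDerivOneForm φ α (φ.symm y) =
      ∑ i, ∑ j, (∑ l, pd i (b l) y * pd j (T l) y) • e i j := by
    rw [extDerivOneForm, φ.right_inv hy]
    simp only [h6, Finset.sum_add_distrib, add_smul]
    exact (congrArg (· + _) h7).trans (zero_add _)
  rw [h9, extDerivOneForm]
  simp only [h4, map_sum, map_smul, Finset.sum_mul, Finset.mul_sum, smul_mul_assoc,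
    mul_smul_comm, Finset.smul_sum, smul_smul, Finset.sum_smul, h5]
  calc _ = ∑ i, ∑ j, ∑ k, ∑ l, (pd k (formCoeff ψ α l) (ψ (φ.symm y)) * pd i (T k) y *
        pd j (T l) y) • e i j :=
        Finset.sum_congr rfl fun _ _ => Finset.sum_congr rfl fun _ _ => Finset.sum_comm
    _ = ∑ i, ∑ k, ∑ j, ∑ l, (pd k (formCoeff ψ α l) (ψ (φ.symm y)) * pd i (T k) y *
        pd j (T l) y) • e i j := Finset.sum_congr rfl fun _ _ => Finset.sum_comm
    _ = ∑ k, ∑ i, ∑ j, ∑ l, (pd k (formCoeff ψ α l) (ψ (φ.symm y)) * pd i (T k) y *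
        pd j (T l) y) • e i j := Finset.sum_comm
    _ = ∑ k, ∑ i, ∑ l, ∑ j, (pd k (formCoeff ψ α l) (ψ (φ.symm y)) * pd i (T k) y *
        pd j (T l) y) • e i j :=
        Finset.sum_congr rfl fun _ _ => Finset.sum_congr rfl fun _ _ => Finset.sum_comm
    _ = ∑ k, ∑ l, ∑ i, ∑ j, (pd k (formCoeff ψ α l) (ψ (φ.symm y)) * pd i (T k) y *
        pd j (T l) y) • e i j := Finset.sum_congr rfl fun _ _ => Finset.sum_comm
    _ = _ := by
      refine Finset.sum_congr rfl fun k _ => Finset.sum_congr rfl fun l _ => ?_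
      rw [Finset.sum_comm]
      refine Finset.sum_congr rfl fun j _ => Finset.sum_congr rfl fun i _ => ?_
      rw [mul_assoc, mul_comm (pd i (T k) y)]

end ChartIndependence

/-! ### The zero set of the twist -/

section Global

variable {m : ℕ} {M : Type*} [TopologicalSpace M]
  [ChartedSpace (EuclideanSpace ℝ (Fin (m + 2))) M] [IsManifold (𝓡 (m + 2)) ∞ M]
  {g : PseudoRiemannianMetric (m + 2) M} {K : Fin m → ∀ p : M, TangentSpace (𝓡 (m + 2)) p}
  {φ : OpenPartialHomeomorph M (EuclideanSpace ℝ (Fin (m + 2)))}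

theorem extDerivOneForm_mul_wedge_eq_zero_iff (hφ : φ ∈ IsManifold.maximalAtlas (𝓡 (m + 2)) ∞ M)
    (X : ∀ p : M, TangentSpace (𝓡 (m + 2)) p) {p : M} (hp : p ∈ φ.source) :
    extDerivOneForm φ (flat g X) p * wedge (fun ν => flat g (K ν)) p = 0 ↔
      twistFun (metricCoeff g φ) (vecCoeff φ X) (fun ν => vecCoeff φ (K ν)) (φ p) = 0 := by
  obtain ⟨y, hy, rfl⟩ : ∃ y ∈ φ.target, φ.symm y = p := ⟨φ p, φ.map_source hp, φ.left_inv hp⟩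
  rw [φ.right_inv hy]
  let c : Module.Dual ℝ (TangentSpace (𝓡 (m + 2)) (φ.symm y)) ≃ₗ[ℝ] (Fin (m + 2) → ℝ) :=
    { toFun := fun β j => β (coordVec φ j y)
      map_add' := fun _ _ => rfl
      map_smul' := fun _ _ => rfl
      invFun := fun u => ∑ j, u j • coordCovec φ j (φ.symm y)
      left_inv := fun β => by
        ext v
        conv_rhs => rw [← sum_coordCovec_smul_coordVec hφ hy v]
        rw [map_sum, LinearMap.sum_apply]
        refine Finset.sum_congr rfl fun l _ => ?_
        rw [map_smul, smul_eq_mul, LinearMap.smul_apply, smul_eq_mul, mul_comm]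
      right_inv := fun u => by
        ext j
        change (∑ l, u l • coordCovec φ l (φ.symm y)) (coordVec φ j y) = u j
        rw [LinearMap.sum_apply]
        simp [coordCovec_coordVec hφ hy] }
  have hc : ∀ i, c (coordCovec φ i (φ.symm y)) = Pi.single i 1 := by
    intro i
    ext j
    change coordCovec φ i (φ.symm y) (coordVec φ j y) = _
    rw [coordCovec_coordVec hφ hy, Pi.single_apply]
    simp [eq_comm]
  have hcK : (fun ν => c (flat g (K ν) (φ.symm y))) =
      fun ν j => lower (metricCoeff g φ) (vecCoeff φ (K ν)) j y := by
    ext ν j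
    exact formCoeff_flat g hφ (K ν) j hy
  have hpd : (fun i j => pd i (formCoeff φ (flat g X) j) y) =
      fun i j => pd i (lower (metricCoeff g φ) (vecCoeff φ X) j) y := by
    ext i j
    exact pd_congr φ.open_target hy (fun z hz => formCoeff_flat g hφ X j hz) i
  have h := sum_smul_ι_mul_ιMulti_eq_zero_iff c (fun i => coordCovec φ i (φ.symm y)) hc
    (fun i j => pd i (formCoeff φ (flat g X) j) y) (fun ν => flat g (K ν) (φ.symm y))
  rw [hcK, hpd, twist_lower_eq_zero_iff (isMetricOn_metricCoeff g hφ) hy] at h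
  rw [← h, extDerivOneForm, wedge, φ.right_inv hy]

/-- The points at which `dX ∧ K₀ ∧ … ∧ Kₘ₋₁` vanishes, in all charts. -/
def twistZeroSet (g : PseudoRiemannianMetric (m + 2) M)
    (K : Fin m → ∀ p : M, TangentSpace (𝓡 (m + 2)) p) (X : ∀ p : M, TangentSpace (𝓡 (m + 2)) p) :
    Set M :=
  {p | ∀ φ ∈ IsManifold.maximalAtlas (𝓡 (m + 2)) ∞ M, p ∈ φ.source →
    extDerivOneForm φ (flat g X) p * wedge (fun ν => flat g (K ν)) p = 0}

theorem mem_twistZeroSet_iff (hφ : φ ∈ IsManifold.maximalAtlas (𝓡 (m + 2)) ∞ M)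
    {X : ∀ p : M, TangentSpace (𝓡 (m + 2)) p} (hX : ContMDiff (𝓡 (m + 2)) (𝓡 (m + 2)).tangent ∞
      (fun p : M => (⟨p, X p⟩ : TangentBundle (𝓡 (m + 2)) M))) {p : M} (hp : p ∈ φ.source) :
    p ∈ twistZeroSet g K X ↔
      twistFun (metricCoeff g φ) (vecCoeff φ X) (fun ν => vecCoeff φ (K ν)) (φ p) = 0 := by
  rw [← extDerivOneForm_mul_wedge_eq_zero_iff hφ X hp]
  refine ⟨fun h => h φ hφ hp, fun h ψ hψ hp' => ?_⟩
  rw [extDerivOneForm_eq hψ hφ _ (contDiffOn_formCoeff_flat g hφ hX) hp' hp, h]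

theorem isOpen_twistZeroSet (hvac : IsVacuum g) (hK : ∀ ν, IsKilling g (K ν))
    (hcomm : ∀ μ ν, VectorField.mlieBracket (𝓡 (m + 2)) (K μ) (K ν) = 0) (μ : Fin m) :
    IsOpen (twistZeroSet g K (K μ)) := by
  obtain ⟨r, hric⟩ := hvac
  rw [isOpen_iff_mem_nhds]
  intro p hp
  set φ := chartAt (EuclideanSpace ℝ (Fin (m + 2))) p
  have hφ : φ ∈ IsManifold.maximalAtlas (𝓡 (m + 2)) ∞ M := IsManifold.chart_mem_maximalAtlas p
  have hpφ : p ∈ φ.source := mem_chart_source _ p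
  have h := eventually_twistFun_eq_zero (isMetricOn_metricCoeff g hφ)
    (fun ν => isKillingOn_vecCoeff hφ (hK ν))
    (fun i j z hz => jacobian_mulVec_comm hφ (hK i).contMDiff (hK j).contMDiff (hcomm i j) hz)
    (hric φ hφ) μ (φ.map_source hpφ) ((mem_twistZeroSet_iff hφ (hK μ).contMDiff hpφ).1 hp)
  filter_upwards [(φ.continuousAt hpφ).eventually h, φ.open_source.mem_nhds hpφ] with q hq hqφ
  exact (mem_twistZeroSet_iff hφ (hK μ).contMDiff hqφ).2 hq

theorem isClosed_twistZeroSet (hK : ∀ ν, IsKilling g (K ν)) (μ : Fin m) :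
    IsClosed (twistZeroSet g K (K μ)) := by
  rw [← isOpen_compl_iff, isOpen_iff_mem_nhds]
  intro p hp
  set φ := chartAt (EuclideanSpace ℝ (Fin (m + 2))) p
  have hφ : φ ∈ IsManifold.maximalAtlas (𝓡 (m + 2)) ∞ M := IsManifold.chart_mem_maximalAtlas p
  have hpφ : p ∈ φ.source := mem_chart_source _ p
  have h0 := mt (mem_twistZeroSet_iff hφ (hK μ).contMDiff hpφ).2 hp
  have hc := (differentiableAt_twistFun (isMetricOn_metricCoeff g hφ)
    (isKillingOn_vecCoeff hφ (hK μ)).smooth (fun ν => (isKillingOn_vecCoeff hφ (hK ν)).smooth)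
    (φ.map_source hpφ)).continuousAt
  filter_upwards [(φ.continuousAt hpφ).eventually (hc.eventually_ne h0),
    φ.open_source.mem_nhds hpφ] with q hq hqφ
  exact fun hqS => hq ((mem_twistZeroSet_iff hφ (hK μ).contMDiff hqφ).1 hqS)

/-- Commuting Killing fields of a connected Einstein manifold of dimension `m + 2` have vanishing
twist if their wedge product vanishes somewhere. -/
theorem extDerivOneForm_mul_wedge_eq_zero [ConnectedSpace M] (hvac : IsVacuum g)
    (hK : ∀ ν, IsKilling g (K ν))
    (hcomm : ∀ μ ν, VectorField.mlieBracket (𝓡 (m + 2)) (K μ) (K ν) = 0)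
    (hdgt : {p : M | wedge (fun μ => flat g (K μ)) p = 0}.Nonempty) (μ : Fin m)
    (hφ : φ ∈ IsManifold.maximalAtlas (𝓡 (m + 2)) ∞ M) {p : M} (hp : p ∈ φ.source) :
    extDerivOneForm φ (flat g (K μ)) p * wedge (fun ν => flat g (K ν)) p = 0 := by
  obtain ⟨q, hq⟩ := hdgt
  have hclopen : IsClopen (twistZeroSet g K (K μ)) :=
    ⟨isClosed_twistZeroSet hK μ, isOpen_twistZeroSet hvac hK hcomm μ⟩
  have huniv := hclopen.eq_univ ⟨q, fun ψ _ _ => by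
    rw [show wedge (fun ν => flat g (K ν)) q = 0 from hq, mul_zero]⟩
  have hmem : p ∈ twistZeroSet g K (K μ) := huniv ▸ Set.mem_univ p
  exact hmem φ hφ hp

end Global

end KillingGeometry

end

theorem mainTheorem12 (n : ℕ) (M : Type*) [TopologicalSpace M] [ConnectedSpace M]
    [ChartedSpace (EuclideanSpace ℝ (Fin (n + 1))) M] [IsManifold (𝓡 (n + 1)) ∞ M]
    (g : KillingGeometry.PseudoRiemannianMetric (n + 1) M)
    (hvac : KillingGeometry.IsVacuum g)
    (K : Fin (n - 1) → ∀ p : M, TangentSpace (𝓡 (n + 1)) p)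
    (hK : ∀ μ, KillingGeometry.IsKilling g (K μ))
    (hcomm : ∀ μ ν, VectorField.mlieBracket (𝓡 (n + 1)) (K μ) (K ν) = 0)
    (hlin : LinearIndependent ℝ K)
    (hdgt : {p : M | KillingGeometry.wedge (fun μ => KillingGeometry.flat g (K μ)) p = 0}.Nonempty) :
    ∀ μ : Fin (n - 1), ∀ φ ∈ IsManifold.maximalAtlas (𝓡 (n + 1)) ∞ M, ∀ p ∈ φ.source,
      KillingGeometry.extDerivOneForm φ (KillingGeometry.flat g (K μ)) p *
        KillingGeometry.wedge (fun ν => KillingGeometry.flat g (K ν)) p = 0 := by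
  cases n with
  | zero => exact fun μ => μ.elim0
  | succ m =>
    exact fun μ φ hφ p hp =>
      KillingGeometry.extDerivOneForm_mul_wedge_eq_zero (m := m) hvac hK hcomm hdgt μ hφ hp
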